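/- Let $\mathcal H$ be a finite-dimensional or separable infinite-dimensional complex Hilbert space, $d=\dim\mathcal H\le+\infty$. A state is a positive trace-class operator on $\mathcal H$ with unit trace, and $\|A\|_1=\mathrm{Tr}\sqrt{A^*A}$ denotes the trace norm. Let $\{p_i,\rho_i\}$ be an ensemble of $n\le+\infty$ states, i.e. a finite or countably infinite collection of $n$ states $\rho_i$ on $\mathcal H$ together with a probability distribution $\{p_i\}$, and let $\bar\rho=\sum_i p_i\rho_i$ be its average state. The Holevo quantity of the ensemble is $$\chi(\{p_i,\rho_i\})=\sum_i p_i\,H(\rho_i\|\bar\rho)\in[0,+\infty],$$ where the quantum relative entropy of states $\rho,\sigma$ is $H(\rho\|\sigma)=\sum_k\langle k|\,\rho\log\rho-\rho\log\sigma\,|k\rangle$ with $\{|k\rangle\}$ an orthonormal basis of eigenvectors of $\rho$, and $H(\rho\|\sigma)=+\infty$ if $\mathrm{supp}\,\rho\not\subseteq\mathrm{supp}\,\sigma$. Let $$\varepsilon_{\mathrm{av}}=\tfrac12\inf_{\sigma}\sum_i p_i\|\rho_i-\sigma\|_1$$ be the average metric divergence of the ensemble, the infimum being over all states $\sigma$ on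 $\mathcal H$, and let $g(\varepsilon)=(1+\varepsilon)\,h_2\!\left(\frac{\varepsilon}{1+\varepsilon}\right)$, where $h_2(p)=-p\log p-(1-p)\log(1-p)$, with $0\log 0=0$, is the binary entropy. Then $$\chi(\{p_i,\rho_i\})\le\varepsilon_{\mathrm{av}}\log n+g(\varepsilon_{\mathrm{av}})\qquad\text{and}\qquad \chi(\{p_i,\rho_i\})\le\varepsilon_{\mathrm{av}}\log d+g(\varepsilon_{\mathrm{av}}),$$ where $\log$ is the natural logarithm throughout, $\log(+\infty)=+\infty$ and $0\cdot(+\infty)=0$. -/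

import Mathlib

open scoped ENNReal InnerProductSpace

noncomputable section

namespace Quantum

universe u v

variable {H : Type u} [NormedAddCommGroup H] [InnerProductSpace ℂ H] [CompleteSpace H]

/-! ### Trace, trace norm, states -/

variable (H) in
/-- The index set of a fixed orthonormal (Hilbert) basis of `H`. -/
def refIndex : Set H := (exists_hilbertBasis ℂ H).choose

variable (H) in
/-- A fixed orthonormal (Hilbert) basis of `H`, used to write down traces. -/
def refBasis : HilbertBasis (refIndex H) ℂ H := (exists_hilbertBasis ℂ H).choose_spec.choose

/-- The trace `∑ᵢ ⟨i|T|i⟩ ∈ [0, ∞]` of a positive operator `T`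
(its value does not depend on the orthonormal basis). -/
def posTrace (T : H →L[ℂ] H) : ℝ≥0∞ :=
  ∑' i, ENNReal.ofReal (⟪refBasis H i, T (refBasis H i)⟫_ℂ).re

/-- The trace norm `‖T‖₁ = Tr |T|`, where `|T| = √(T* T)`. -/
def traceNorm (T : H →L[ℂ] H) : ℝ≥0∞ := posTrace (CFC.abs T)

variable (H) in
/-- A quantum state: a positive operator with unit trace. -/
structure State where
  op : H →L[ℂ] H
  pos : op.IsPositive
  trace_eq_one : posTrace op = 1

namespace State

/-- The support of a state: the orthogonal complement of its kernel. -/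
def supp (ρ : State H) : Submodule ℂ H := (LinearMap.ker ρ.op.toLinearMap)ᗮ

theorem exists_sqrt (ρ : State H) : ∃ S : H →L[ℂ] H, S.IsSymmetric ∧ S ∘L S = ρ.op ∧
    HasSum (fun i => ‖S (refBasis H i)‖ ^ 2) 1 := by
  have h0 : (0 : H →L[ℂ] H) ≤ ρ.op := (ContinuousLinearMap.nonneg_iff_isPositive _).2 ρ.pos
  have hS : (CFC.sqrt ρ.op).IsPositive :=
    (ContinuousLinearMap.nonneg_iff_isPositive _).1 (CFC.sqrt_nonneg _)
  have hSS : CFC.sqrt ρ.op ∘L CFC.sqrt ρ.op = ρ.op := CFC.sqrt_mul_sqrt_self _ h0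
  refine ⟨CFC.sqrt ρ.op, hS.isSymmetric, hSS, ?_⟩
  have key : ∀ x : H, (⟪x, ρ.op x⟫_ℂ).re = ‖CFC.sqrt ρ.op x‖ ^ 2 := by
    intro x
    have h1 : ⟪x, ρ.op x⟫_ℂ = ⟪CFC.sqrt ρ.op x, CFC.sqrt ρ.op x⟫_ℂ := by
      conv_lhs => rw [← hSS]
      exact (hS.isSymmetric x _).symm
    rw [h1]
    exact inner_self_eq_norm_sq (𝕜 := ℂ) _
  have ht := ρ.trace_eq_one
  unfold posTrace at ht
  simp only [key] at ht
  have := ENNReal.hasSum_toReal (by rw [ht]; simp :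
    (∑' i, ENNReal.ofReal (‖CFC.sqrt ρ.op (refBasis H i)‖ ^ 2)) ≠ ⊤)
  have h2 : (fun i => (ENNReal.ofReal (‖CFC.sqrt ρ.op (refBasis H i)‖ ^ 2)).toReal) =
      fun i => ‖CFC.sqrt ρ.op (refBasis H i)‖ ^ 2 := by
    funext i; exact ENNReal.toReal_ofReal (by positivity)
  rw [← ENNReal.tsum_toReal_eq (by simp), ht, h2] at this
  simpa using this

theorem norm_sq_finset_sum_le {S : H →L[ℂ] H} (F : Finset (refIndex H)) (x : H) :
    ‖∑ i ∈ F, ⟪S (refBasis H i), x⟫_ℂ • refBasis H i‖ ^ 2 ≤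
      (∑ i ∈ F, ‖S (refBasis H i)‖ ^ 2) * ‖x‖ ^ 2 := by
  have h := (refBasis H).orthonormal.inner_sum (fun i => ⟪S (refBasis H i), x⟫_ℂ)
    (fun i => ⟪S (refBasis H i), x⟫_ℂ) F
  have h' := congrArg Complex.re h
  have h1 : (⟪∑ i ∈ F, ⟪S (refBasis H i), x⟫_ℂ • refBasis H i,
    ∑ i ∈ F, ⟪S (refBasis H i), x⟫_ℂ • refBasis H i⟫_ℂ).re =
      ‖∑ i ∈ F, ⟪S (refBasis H i), x⟫_ℂ • refBasis H i‖ ^ 2 := inner_self_eq_norm_sq (𝕜 := ℂ) _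
  rw [← h1, h', Complex.re_sum, Finset.sum_mul]
  refine Finset.sum_le_sum fun i _ => ?_
  rw [← Complex.normSq_eq_conj_mul_self, Complex.ofReal_re, Complex.normSq_eq_norm_sq, ← mul_pow]
  gcongr
  exact norm_inner_le_norm _ _

theorem hasSum_of_isSymmetric {S : H →L[ℂ] H} (hS : S.IsSymmetric) (x : H) :
    HasSum (fun i => ⟪S (refBasis H i), x⟫_ℂ • refBasis H i) (S x) := by
  have h := (refBasis H).hasSum_repr (S x)
  have h1 : (fun i => (refBasis H).repr (S x) i • refBasis H i) =
      fun i => ⟪S (refBasis H i), x⟫_ℂ • refBasis H i := by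
    funext i
    rw [HilbertBasis.repr_apply_apply]
    congr 1
    exact (hS _ _).symm
  rwa [h1] at h

theorem norm_le_one (ρ : State H) : ‖ρ.op‖ ≤ 1 := by
  obtain ⟨S, hS, hSS, hsum⟩ := ρ.exists_sqrt
  have hS1 : ‖S‖ ≤ 1 := by
    refine ContinuousLinearMap.opNorm_le_bound _ zero_le_one fun x => ?_
    rw [one_mul]
    have hx : Filter.Tendsto (fun F : Finset (refIndex H) =>
        ‖∑ i ∈ F, ⟪S (refBasis H i), x⟫_ℂ • refBasis H i‖ ^ 2) Filter.atTop
          (nhds (‖S x‖ ^ 2)) := ((hasSum_of_isSymmetric hS x).norm.pow 2)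
    have : ‖S x‖ ^ 2 ≤ ‖x‖ ^ 2 := by
      refine le_of_tendsto' hx fun F => (norm_sq_finset_sum_le F x).trans ?_
      have : ∑ i ∈ F, ‖S (refBasis H i)‖ ^ 2 ≤ 1 :=
        sum_le_hasSum F (fun i _ => by positivity) hsum
      nlinarith [sq_nonneg ‖x‖]
    exact (sq_le_sq₀ (norm_nonneg _) (norm_nonneg _)).1 this
  rw [← hSS]
  calc ‖S ∘L S‖ ≤ ‖S‖ * ‖S‖ := ContinuousLinearMap.opNorm_comp_le _ _
    _ ≤ 1 := by nlinarith [norm_nonneg S]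

theorem isCompactOperator (ρ : State H) : IsCompactOperator ρ.op := by
  obtain ⟨S, hS, hSS, hsum⟩ := ρ.exists_sqrt
  let R : refIndex H → (H →L[ℂ] H) := fun i =>
    (ContinuousLinearMap.toSpanSingleton ℂ (refBasis H i)) ∘L innerSL ℂ (S (refBasis H i))
  have hR : ∀ (F : Finset (refIndex H)) (x : H), (∑ i ∈ F, R i) x =
      ∑ i ∈ F, ⟪S (refBasis H i), x⟫_ℂ • refBasis H i := by
    intro F x
    simp [R]
  have hRsum : Summable R := by
    rw [summable_iff_vanishing_norm]
    intro ε hε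
    obtain ⟨F, hF⟩ := summable_iff_vanishing_norm.1 hsum.summable ((ε / 2) ^ 2) (by positivity)
    refine ⟨F, fun G hG => ?_⟩
    have h1 := hF G hG
    rw [Real.norm_of_nonneg (Finset.sum_nonneg fun i _ => by positivity)] at h1
    refine lt_of_le_of_lt ?_ (half_lt_self hε)
    refine ContinuousLinearMap.opNorm_le_bound _ (by positivity) fun x => ?_
    rw [hR]
    refine (sq_le_sq₀ (norm_nonneg _) (by positivity)).1 ?_
    refine (norm_sq_finset_sum_le G x).trans ?_
    rw [mul_pow]
    gcongr
  have hRS : ∑' i, R i = S := by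
    ext x
    have h1 : HasSum (fun i => R i x) ((∑' i, R i) x) :=
      hRsum.hasSum.mapL (ContinuousLinearMap.apply ℂ H x)
    exact h1.unique (by simpa [R] using hasSum_of_isSymmetric hS x)
  have hcR : ∀ i, IsCompactOperator (R i) := fun i =>
    (isCompactOperator_of_locallyCompactSpace_rng
      (ContinuousLinearMap.toSpanSingleton ℂ (refBasis H i))).comp_clm _
  have hcS : IsCompactOperator S := by
    have ht : Filter.Tendsto (fun F : Finset (refIndex H) => ∑ i ∈ F, R i) Filter.atTop (nhds S) :=
      hRS ▸ hRsum.hasSum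
    refine isCompactOperator_of_tendsto ht (Filter.Eventually.of_forall fun F => ?_)
    exact (compactOperator (RingHom.id ℂ) H H).sum_mem (fun i _ => hcR i)
  rw [← hSS]
  exact hcS.comp_clm S

end State

/-! ### Eigenbases -/

/-- An orthonormal basis of `H` consisting of eigenvectors of `T`, with real eigenvalues. -/
structure EigenBasis (T : H →L[ℂ] H) where
  idx : Type u
  basis : HilbertBasis idx ℂ H
  eigenvalue : idx → ℝ
  apply_basis : ∀ i, T (basis i) = (eigenvalue i : ℂ) • basis i

theorem State.exists_eigenBasis (ρ : State H) : Nonempty (EigenBasis ρ.op) := by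
  have hsym : (ρ.op : H →ₗ[ℂ] H).IsSymmetric := ρ.pos.isSymmetric
  have horth := hsym.orthogonalFamily_eigenspaces
  have hbot := ContinuousLinearMap.orthogonalComplement_iSup_eigenspaces_eq_bot
    ρ.isCompactOperator ρ.pos.isSymmetric
  have hcl : ∀ μ : ℂ, CompleteSpace (Module.End.eigenspace (ρ.op : Module.End ℂ H) μ) := by
    intro μ
    have : IsClosed ((Module.End.eigenspace (ρ.op : Module.End ℂ H) μ : Set H)) := by
      have : (Module.End.eigenspace (ρ.op : Module.End ℂ H) μ : Set H) =
          {x | ρ.op x = μ • x} := by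
        ext x; simp
      rw [this]
      exact isClosed_eq ρ.op.continuous (continuous_const_smul μ)
    exact this.completeSpace_coe
  choose w b hb using fun μ : ℂ =>
    exists_hilbertBasis ℂ (Module.End.eigenspace (ρ.op : Module.End ℂ H) μ)
  have hon := horth.orthonormal_sigma_orthonormal (fun μ => (b μ).orthonormal)
  have hsp : (Submodule.span ℂ (Set.range fun a : Σ μ, w μ => ((b a.1 a.2 : _) : H)))ᗮ = ⊥ := by
    rw [eq_bot_iff, ← hbot]
    intro x hx
    rw [Submodule.mem_orthogonal] at hx
    rw [← Submodule.iInf_orthogonal, Submodule.mem_iInf]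
    intro μ
    rw [Submodule.mem_orthogonal]
    intro y hy
    have h1 := ((b μ).hasSum_repr ⟨y, hy⟩).mapL
      ((Module.End.eigenspace (ρ.op : Module.End ℂ H) μ).subtypeL)
    have h2 := h1.mapL (innerSL ℂ x)
    have h3 : (fun i => innerSL ℂ x ((Module.End.eigenspace (ρ.op : Module.End ℂ H) μ).subtypeL
        ((b μ).repr ⟨y, hy⟩ i • b μ i))) = fun _ => (0 : ℂ) := by
      funext i
      have h4 : ⟪x, (b μ i : H)⟫_ℂ = 0 := by
        rw [← inner_conj_symm, hx _ (Submodule.subset_span ⟨⟨μ, i⟩, rfl⟩), map_zero]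
      simp [h4]
    rw [h3] at h2
    have h5 : ⟪x, y⟫_ℂ = 0 := h2.unique hasSum_zero
    rw [← inner_conj_symm, h5, map_zero]
  let B := HilbertBasis.mkOfOrthogonalEqBot hon hsp
  have hB : ∀ a : Σ μ, w μ, B a = ((b a.1 a.2 : _) : H) := fun a =>
    congrFun (HilbertBasis.coe_mkOfOrthogonalEqBot hon hsp) a
  refine ⟨⟨_, B, fun a => a.1.re, fun a => ?_⟩⟩
  have hmem : B a ∈ Module.End.eigenspace (ρ.op : Module.End ℂ H) a.1 := by
    rw [hB]; exact (b a.1 a.2).2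
  have hne : B a ≠ 0 := B.orthonormal.ne_zero a
  have hreal : (a.1.re : ℂ) = a.1 := Complex.conj_eq_iff_re.1
    (hsym.conj_eigenvalue_eq_self (Module.End.hasEigenvalue_of_hasEigenvector ⟨hmem, hne⟩))
  rw [hreal]
  exact Module.End.mem_eigenspace_iff.1 hmem

/-- An orthonormal basis of eigenvectors of a state. -/
def State.eigenBasis (ρ : State H) : EigenBasis ρ.op := Classical.choice ρ.exists_eigenBasis

/-! ### Relative entropy -/

/-- The value `⟨x| -log σ |x⟩ = ∑ⱼ |⟨j|x⟩|² (-log μⱼ) ∈ [0, ∞]` of the quadratic form of the positive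
(in general unbounded) operator `-log σ`, where `|j⟩` is an orthonormal basis of eigenvectors of `σ`
with eigenvalues `μⱼ ∈ [0, 1]`. The logarithm is taken on the support of `σ`: as `Real.log 0 = 0`,
the eigenvectors with `μⱼ = 0` do not contribute. -/
def negLogForm (σ : State H) (x : H) : ℝ≥0∞ :=
  ∑' j, ENNReal.ofReal (‖⟪σ.eigenBasis.basis j, x⟫_ℂ‖ ^ 2) *
    ENNReal.ofReal (-Real.log (σ.eigenBasis.eigenvalue j))

open Classical in
/-- The quantum relative entropy `H(ρ‖σ) = ∑ᵢ ⟨i| ρ log ρ - ρ log σ |i⟩`, where `|i⟩` is an orthonormal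
basis of eigenvectors of `ρ` (with eigenvalues `λᵢ`, so that the `i`-th term is
`λᵢ log λᵢ + λᵢ ⟨i| -log σ |i⟩ ∈ (-∞, ∞]`), and `H(ρ‖σ) = ∞` if `supp ρ` is not contained
in `supp σ`. -/
def relEntropy (ρ σ : State H) : EReal :=
  if ρ.supp ≤ σ.supp then
    ∑' i, (((ρ.eigenBasis.eigenvalue i * Real.log (ρ.eigenBasis.eigenvalue i) : ℝ) : EReal) +
      ((ENNReal.ofReal (ρ.eigenBasis.eigenvalue i) * negLogForm σ (ρ.eigenBasis.basis i) : ℝ≥0∞) :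
        EReal))
  else ⊤

/-! ### Ensembles -/

variable (H) in
/-- An ensemble of quantum states indexed by `ι`: states `ρᵢ` with a probability distribution `pᵢ`. -/
structure Ensemble (ι : Type v) where
  prob : ι → ℝ
  prob_nonneg : ∀ i, 0 ≤ prob i
  hasSum_prob : HasSum prob 1
  state : ι → State H

namespace Ensemble

variable {ι : Type v} (E : Ensemble H ι)

theorem summable_smul : Summable fun i => (E.prob i : ℂ) • (E.state i).op := by
  refine Summable.of_norm_bounded E.hasSum_prob.summable fun i => ?_
  rw [norm_smul, Complex.norm_real, Real.norm_of_nonneg (E.prob_nonneg i)]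
  exact mul_le_of_le_one_right (E.prob_nonneg i) (E.state i).norm_le_one

theorem hasSum_inner (x : H) :
    HasSum (fun i => E.prob i * (⟪x, (E.state i).op x⟫_ℂ).re)
      (⟪x, (∑' i, (E.prob i : ℂ) • (E.state i).op) x⟫_ℂ).re := by
  have h1 := E.summable_smul.hasSum.mapL (ContinuousLinearMap.apply ℂ H x)
  have h2 := Complex.hasSum_re (h1.mapL (innerSL ℂ x))
  have h3 : (fun i => (innerSL ℂ x (ContinuousLinearMap.apply ℂ H x
      ((E.prob i : ℂ) • (E.state i).op))).re) =
        fun i => E.prob i * (⟪x, (E.state i).op x⟫_ℂ).re := by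
    funext i
    simp
  rw [h3] at h2
  exact h2

/-- The average state `∑ᵢ pᵢ ρᵢ`. -/
def average : State H where
  op := ∑' i, (E.prob i : ℂ) • (E.state i).op
  pos := by
    rw [← ContinuousLinearMap.nonneg_iff_isPositive]
    refine tsum_nonneg fun i => ?_
    rw [ContinuousLinearMap.nonneg_iff_isPositive]
    exact (E.state i).pos.smul_of_nonneg (by exact_mod_cast E.prob_nonneg i)
  trace_eq_one := by
    have h0 : ∀ i (x : H), 0 ≤ (⟪x, (E.state i).op x⟫_ℂ).re := fun i x =>
      (E.state i).pos.re_inner_nonneg_right x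
    unfold posTrace
    have h1 : ∀ j, ENNReal.ofReal
        (⟪refBasis H j, (∑' i, (E.prob i : ℂ) • (E.state i).op) (refBasis H j)⟫_ℂ).re =
        ∑' i, ENNReal.ofReal (E.prob i) *
          ENNReal.ofReal (⟪refBasis H j, (E.state i).op (refBasis H j)⟫_ℂ).re := by
      intro j
      rw [← (E.hasSum_inner (refBasis H j)).tsum_eq,
        ENNReal.ofReal_tsum_of_nonneg (fun i => mul_nonneg (E.prob_nonneg i) (h0 i _))
          (E.hasSum_inner (refBasis H j)).summable]
      exact tsum_congr fun i => ENNReal.ofReal_mul (E.prob_nonneg i)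
    simp_rw [h1]
    rw [ENNReal.tsum_comm]
    have h2 : ∀ i, ∑' j, ENNReal.ofReal (E.prob i) *
        ENNReal.ofReal (⟪refBasis H j, (E.state i).op (refBasis H j)⟫_ℂ).re =
        ENNReal.ofReal (E.prob i) := by
      intro i
      rw [ENNReal.tsum_mul_left]
      have := (E.state i).trace_eq_one
      unfold posTrace at this
      rw [this, mul_one]
    simp_rw [h2]
    rw [← ENNReal.ofReal_tsum_of_nonneg E.prob_nonneg E.hasSum_prob.summable,
      E.hasSum_prob.tsum_eq, ENNReal.ofReal_one]

/-- The Holevo quantity `χ = ∑ᵢ pᵢ H(ρᵢ‖ρ̄) ∈ [0, ∞]`, where `ρ̄` is the average state. -/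
def holevo : EReal := ∑' i, (E.prob i : EReal) * relEntropy (E.state i) E.average

/-- The metric divergence `½ ∑ᵢ pᵢ ‖ρᵢ - σ‖₁` of the ensemble with respect to a state `σ`. -/
def metricDivergence (σ : State H) : ℝ≥0∞ :=
  2⁻¹ * ∑' i, ENNReal.ofReal (E.prob i) * traceNorm ((E.state i).op - σ.op)

/-- The average metric divergence `½ inf_σ ∑ᵢ pᵢ ‖ρᵢ - σ‖₁`, the infimum being over all states `σ`
(a number in `[0, 1]`, as `‖ρᵢ - σ‖₁ ≤ 2`). -/
def avgMetricDivergence : ℝ := (⨅ σ : State H, E.metricDivergence σ).toReal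

end Ensemble

/-- The function `g(ε) = (1 + ε) h₂(ε / (1 + ε))`, where `h₂` is the binary entropy. -/
def g (ε : ℝ) : ℝ := (1 + ε) * Real.binEntropy (ε / (1 + ε))

end Quantum

end

open scoped ENNReal InnerProductSpace

noncomputable section

namespace Quantum

universe u v

open MeasureTheory Filter Topology Set

/-! ### An integral representation of the scalar relative entropy -/

/-! Fix a state σ and let P_i, N_i be the positive and negative parts of ρ_i − σ. Then ρ_i + N_i = σ
+ P_i and Tr P_i = Tr N_i = e_i, with ∑ p_i e_i = ε the metric divergence from σ. Write D(A‖B) = Tr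
A log A − Tr A log B, take Δ ≥ 0 of trace ε, and put ω = σ + Δ. Superadditivity of D in its first
argument and joint subadditivity give D(ρ_i‖ω) + D(N_i‖ω) ≤ D(σ + P_i‖σ + Δ) ≤ D(P_i‖Δ), while
Klein's inequality gives D(N_i‖ω) ≥ e_i log e_i − e_i log(1 + ε); this is `relEnt_le_of_add_eq_add`.
Averaging through Donald's identity ∑ p_i D(ρ_i‖ρ̄) = ∑ p_i D(ρ_i‖ω) − D(ρ̄‖ω), with D(ρ̄‖ω) ≥
−log(1 + ε), yields (`tsum_divergence_le`) χ ≤ ∑ p_i (D(P_i‖Δ) − e_i log e_i) + (1 + ε) log(1 + ε).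

Two choices of Δ give the two bounds. For Δ = (ε/d)·1, D(P_i‖Δ) ≤ e_i (log e_i − log(ε/d)), and the
total is ε log d + g(ε). For Δ = ∑ p_i P_i, D(P_i‖Δ) ≤ D(P_i‖p_i P_i) = −e_i log p_i; what remains
is the entropy of the weights p_i e_i, at most ε log n − ε log ε.

Joint subadditivity comes from the integral of (a − b)²/(ta + b) against dt/(1 + t)². Its operator
version has as integrand a supremum of functionals linear in (A, B) (`resolventSup_eq_overlapSum`),
hence is subadditive. The same supremum is lower semicontinuous along finite-dimensional
compressions, so the bound in n for infinite-dimensional H is a limit of finite-dimensional ones.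

The bounds are continuous in ε and pass to the infimum over σ when it is positive. If it is zero,
all states of positive weight coincide and χ vanishes; this also settles the convention 0·∞ = 0. -/

/-- The scalar relative entropy `a log a - a log b - a + b`. -/
def scalarRelEnt (a b : ℝ) : ℝ := a * Real.log a - a * Real.log b - a + b

theorem tendsto_mul_log_sub_log {a b : ℝ} (ha : 0 ≤ a) (hb : 0 < b) :
    Tendsto (fun t => a * Real.log (t * a + b) - a * Real.log (1 + t)) atTop
      (𝓝 (a * Real.log a)) := by
  rcases ha.eq_or_lt with rfl | ha
  · simp
  have h1 : Tendsto (fun t : ℝ => a + (b - a) / (1 + t)) atTop (𝓝 (a + 0)) :=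
    tendsto_const_nhds.add
      (tendsto_const_nhds.div_atTop (tendsto_atTop_add_const_left _ _ tendsto_id))
  rw [add_zero] at h1
  refine ((h1.log ha.ne').const_mul a).congr' ?_
  filter_upwards [eventually_gt_atTop 0] with t ht
  have h2 : a + (b - a) / (1 + t) = (t * a + b) / (1 + t) := by field_simp; ring
  rw [h2, Real.log_div (by positivity) (by positivity), mul_sub]

/-- An explicit primitive is a log(ta + b) − a log(1 + t) + (a − b)/(1 + t). The case b = 0 < a is
excluded: there the integral diverges at 0, while `Real.log 0 = 0` would make the right-hand side
finite. -/
theorem lintegral_resolvent {a b : ℝ} (ha : 0 ≤ a) (hb : 0 ≤ b) (hab : b = 0 → a = 0) :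
    ∫⁻ t in Ioi (0 : ℝ), ENNReal.ofReal ((a - b) ^ 2 / (t * a + b) / (1 + t) ^ 2) =
      ENNReal.ofReal (scalarRelEnt a b) := by
  rcases hb.eq_or_lt with rfl | hb
  · simp [hab rfl, scalarRelEnt]
  have hd : ∀ t ∈ Ici (0 : ℝ), HasDerivAt
      (fun t => a * Real.log (t * a + b) - a * Real.log (1 + t) + (a - b) / (1 + t))
        ((a - b) ^ 2 / (t * a + b) / (1 + t) ^ 2) t := by
    intro t ht
    have ht : 0 ≤ t := ht
    have h1 : 0 < t * a + b := by positivity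
    have h2 : 0 < 1 + t := by positivity
    have d1 : HasDerivAt (fun t => t * a + b) a t := by
      simpa using ((hasDerivAt_id t).mul_const a).add_const b
    have d2 : HasDerivAt (fun t : ℝ => 1 + t) 1 t := by simpa using (hasDerivAt_id t).const_add 1
    refine ((((d1.log h1.ne').const_mul a).sub ((d2.log h2.ne').const_mul a)).add
      ((hasDerivAt_const t (a - b)).div d2 h2.ne')).congr_deriv ?_
    field_simp
    ring
  have hl : Tendsto
      (fun t => a * Real.log (t * a + b) - a * Real.log (1 + t) + (a - b) / (1 + t)) atTop
        (𝓝 (a * Real.log a + 0)) := (tendsto_mul_log_sub_log ha hb).add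
    (tendsto_const_nhds.div_atTop (tendsto_atTop_add_const_left _ _ tendsto_id))
  have hn : ∀ t ∈ Ioi (0 : ℝ), 0 ≤ (a - b) ^ 2 / (t * a + b) / (1 + t) ^ 2 := by
    intro t ht
    have ht : 0 < t := ht
    positivity
  rw [← ofReal_integral_eq_lintegral_ofReal (integrableOn_Ioi_deriv_of_nonneg' hd hn hl)
    ((ae_restrict_iff' measurableSet_Ioi).2 (Eventually.of_forall hn)),
    integral_Ioi_of_hasDerivAt_of_nonneg' hd hn hl]
  congr 1
  simp [scalarRelEnt]
  ring

theorem scalarRelEnt_nonneg {a b : ℝ} (ha : 0 ≤ a) (hb : 0 ≤ b) (hab : b = 0 → a = 0) :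
    0 ≤ scalarRelEnt a b := by
  rcases ha.eq_or_lt with rfl | ha
  · simpa [scalarRelEnt] using hb
  have hb : 0 < b := hb.lt_of_ne fun h => ha.ne' (hab h.symm)
  have h := Real.log_le_sub_one_of_pos (div_pos hb ha)
  rw [Real.log_div hb.ne' ha.ne'] at h
  have h2 := mul_le_mul_of_nonneg_left h ha.le
  have h3 : a * (b / a - 1) = b - a := by field_simp
  unfold scalarRelEnt
  linarith [h3 ▸ h2]

/-! ### A variational formula for the relative entropy -/

section Variational

variable {H : Type u} [NormedAddCommGroup H] [InnerProductSpace ℂ H]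

/-- The value `2 Re Tr Y(A - B) - t Tr A Y*Y - Tr B YY*` at the finite rank operator
`Y = ∑ₛ |fₛ⟩⟨gₛ|`. -/
def resolventForm {κ : Type*} [Fintype κ] (t : ℝ) (f g : κ → H) (A B : H →L[ℂ] H) : ℝ :=
  ∑ s, 2 * (⟪g s, (A - B) (f s)⟫_ℂ).re -
    ∑ s, ∑ r, (t * (⟪f s, f r⟫_ℂ * ⟪g r, A (g s)⟫_ℂ).re + (⟪g s, g r⟫_ℂ * ⟪f r, B (f s)⟫_ℂ).re)

/-- The supremum of `2 Re Tr Y(A - B) - t Tr A Y*Y - Tr B YY*` over all finite rank `Y`. -/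
def resolventSup (t : ℝ) (A B : H →L[ℂ] H) : ℝ≥0∞ :=
  ⨆ (m : ℕ) (f : Fin m → H) (g : Fin m → H), ENNReal.ofReal (resolventForm t f g A B)

/-- The relative entropy `Tr A log A - Tr A log B - Tr A + Tr B`, written as an integral of
suprema of linear functionals of `(A, B)`. -/
def divergence (A B : H →L[ℂ] H) : ℝ≥0∞ :=
  ∫⁻ t in Ioi (0 : ℝ), resolventSup t A B * ENNReal.ofReal ((1 + t) ^ 2)⁻¹

/-- The weighted sum `∑ᵢⱼ |⟨vⱼ, uᵢ⟩|² φ(aᵢ, bⱼ)`. -/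
def overlapSum {I J : Type*} (u : I → H) (v : J → H) (a : I → ℝ) (b : J → ℝ)
    (φ : ℝ → ℝ → ℝ) : ℝ≥0∞ :=
  ∑' s : I × J, ENNReal.ofReal (‖⟪v s.2, u s.1⟫_ℂ‖ ^ 2 * φ (a s.1) (b s.2))

theorem resolventForm_le_resolventSup {κ : Type*} [Fintype κ] (t : ℝ) (f g : κ → H)
    (A B : H →L[ℂ] H) : ENNReal.ofReal (resolventForm t f g A B) ≤ resolventSup t A B := by
  let e := Fintype.equivFin κ
  have h : resolventForm t f g A B = resolventForm t (f ∘ e.symm) (g ∘ e.symm) A B := by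
    unfold resolventForm
    congr 1
    · exact Fintype.sum_equiv e _ _ fun s => by simp
    · exact Fintype.sum_equiv e _ _ fun s => Fintype.sum_equiv e _ _ fun r => by simp
  rw [h]
  exact le_iSup_of_le _ (le_iSup_of_le _ (le_iSup_of_le _ le_rfl))

theorem resolventForm_add {κ : Type*} [Fintype κ] (t : ℝ) (f g : κ → H)
    (A₁ A₂ B₁ B₂ : H →L[ℂ] H) : resolventForm t f g (A₁ + A₂) (B₁ + B₂) =
      resolventForm t f g A₁ B₁ + resolventForm t f g A₂ B₂ := by
  unfold resolventForm
  rw [sub_add_sub_comm, ← Finset.sum_add_distrib, ← Finset.sum_add_distrib]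
  congr 1
  · refine Finset.sum_congr rfl fun s _ => ?_
    simp only [_root_.sub_apply, _root_.add_apply, inner_sub_right, inner_add_right,
      Complex.add_re, Complex.sub_re]
    ring
  · refine Finset.sum_congr rfl fun s _ => ?_
    rw [← Finset.sum_add_distrib]
    refine Finset.sum_congr rfl fun r _ => ?_
    simp only [_root_.add_apply, inner_add_right, mul_add, Complex.add_re]
    ring

/-- Each form is additive in the pair (A, B), and a supremum of additive functions is subadditive.
This is the whole source of joint convexity below. -/
theorem resolventSup_add_le (t : ℝ) (A₁ A₂ B₁ B₂ : H →L[ℂ] H) :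
    resolventSup t (A₁ + A₂) (B₁ + B₂) ≤ resolventSup t A₁ B₁ + resolventSup t A₂ B₂ := by
  refine iSup_le fun m => iSup_le fun f => iSup_le fun g => ?_
  rw [resolventForm_add]
  exact ENNReal.ofReal_add_le.trans (add_le_add (resolventForm_le_resolventSup t f g A₁ B₁)
    (resolventForm_le_resolventSup t f g A₂ B₂))

/-! ### Lower bound for the supremum by eigenvector overlaps -/

section Orthonormal

variable {I J : Type*} {u : I → H} {v : J → H} {a : I → ℝ} {b : J → ℝ} {A B : H →L[ℂ] H}

-- For Y = ∑ y_s |v_j⟩⟨u_i| the rank-one terms of distinct pairs are Hilbert–Schmidt orthogonal and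
-- stay so when weighted by A or B, so the quadratic part is diagonal.
open Classical in
theorem resolventForm_eigenvectors (hu : Orthonormal ℂ u) (hv : Orthonormal ℂ v)
    (hA : A.IsSymmetric) (hAu : ∀ i, A (u i) = (a i : ℂ) • u i)
    (hBv : ∀ j, B (v j) = (b j : ℂ) • v j) (t : ℝ) (S : Finset (I × J)) (y : I × J → ℂ) :
    resolventForm t (fun s : S => y s • v s.1.2) (fun s : S => u s.1.1) A B =
      ∑ s ∈ S, (2 * ((a s.1 - b s.2) * (y s * ⟪u s.1, v s.2⟫_ℂ).re) -
        (t * a s.1 + b s.2) * ‖y s‖ ^ 2) := by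
  unfold resolventForm
  rw [← Finset.sum_coe_sort S, Finset.sum_sub_distrib]
  congr 1
  · refine Finset.sum_congr rfl fun s _ => ?_
    have h1 : ⟪u s.1.1, A (v s.1.2)⟫_ℂ = a s.1.1 * ⟪u s.1.1, v s.1.2⟫_ℂ := by
      have := hA (u s.1.1) (v s.1.2)
      simp only [ContinuousLinearMap.coe_coe] at this
      rw [← this, hAu, inner_smul_left, Complex.conj_ofReal]
    rw [_root_.sub_apply, map_smul, map_smul, hBv, inner_sub_right, inner_smul_right,
      inner_smul_right, inner_smul_right, h1, ← Complex.re_ofReal_mul (a s.1.1 - b s.1.2)]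
    congr 2
    push_cast
    ring
  · refine Finset.sum_congr rfl fun s _ => ?_
    rw [Finset.sum_eq_single s]
    · have hy : (starRingEnd ℂ) (y s) * y s = ((‖y s‖ ^ 2 : ℝ) : ℂ) := by
        rw [← Complex.normSq_eq_conj_mul_self, Complex.normSq_eq_norm_sq]
      have hu1 : ⟪u s.1.1, u s.1.1⟫_ℂ = 1 := by simp [inner_self_eq_norm_sq_to_K, hu.1]
      have hv1 : ⟪v s.1.2, v s.1.2⟫_ℂ = 1 := by simp [inner_self_eq_norm_sq_to_K, hv.1]
      have h1 : ⟪y s • v s.1.2, y s • v s.1.2⟫_ℂ * ⟪u s.1.1, A (u s.1.1)⟫_ℂ =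
          ((a s.1.1 * ‖y s‖ ^ 2 : ℝ) : ℂ) := by
        rw [inner_smul_left, inner_smul_right, hAu, inner_smul_right, hu1, hv1,
          Complex.ofReal_mul, ← hy]
        ring
      have h2 : ⟪u s.1.1, u s.1.1⟫_ℂ * ⟪y s • v s.1.2, B (y s • v s.1.2)⟫_ℂ =
          ((b s.1.2 * ‖y s‖ ^ 2 : ℝ) : ℂ) := by
        rw [map_smul, inner_smul_left, inner_smul_right, hBv, inner_smul_right, hu1, hv1,
          Complex.ofReal_mul, ← hy]
        ring
      rw [h1, h2, Complex.ofReal_re, Complex.ofReal_re]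
      ring
    · intro r _ hrs
      have h : u r.1.1 ≠ u s.1.1 ∨ v s.1.2 ≠ v r.1.2 := by
        by_contra! h
        exact hrs (Subtype.ext (Prod.ext (hu.linearIndependent.injective h.1)
          (hv.linearIndependent.injective h.2.symm)))
      have h1 : ⟪v s.1.2, v r.1.2⟫_ℂ = 0 ∨ ⟪u r.1.1, u s.1.1⟫_ℂ = 0 := by
        rcases h with h | h
        · exact Or.inr (hu.2 fun h' => h (by rw [h']))
        · exact Or.inl (hv.2 fun h' => h (by rw [h']))
      have h2 : ⟪v r.1.2, v s.1.2⟫_ℂ = 0 ∨ ⟪u s.1.1, u r.1.1⟫_ℂ = 0 :=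
        h1.imp inner_eq_zero_symm.1 inner_eq_zero_symm.1
      simp only [inner_smul_left, inner_smul_right, hAu, hBv, map_smul]
      rcases h1 with h1 | h1 <;> rcases h2 with h2 | h2 <;> simp [h1, h2]
    · simp

/-- Completing the square in the diagonal form gives the maximizer y = (a − b)/(ta + b) · ⟨v, u⟩.
Finite sets of pairs suffice as test operators, and only orthonormality is used, so this half holds
in infinite dimensions. -/
theorem overlapSum_le_resolventSup (hu : Orthonormal ℂ u) (hv : Orthonormal ℂ v)
    (hA : A.IsSymmetric) (hAu : ∀ i, A (u i) = (a i : ℂ) • u i)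
    (hBv : ∀ j, B (v j) = (b j : ℂ) • v j) (ha : ∀ i, 0 ≤ a i) (hb : ∀ j, 0 ≤ b j)
    {t : ℝ} (ht : 0 ≤ t) :
    overlapSum u v a b (fun x y => (x - y) ^ 2 / (t * x + y)) ≤ resolventSup t A B := by
  unfold overlapSum
  rw [ENNReal.tsum_eq_iSup_sum]
  refine iSup_le fun S => ?_
  have h := resolventForm_le_resolventSup t
    (fun s : S => (((a s.1.1 - b s.1.2) / (t * a s.1.1 + b s.1.2) : ℝ) * ⟪v s.1.2, u s.1.1⟫_ℂ) •
      v s.1.2) (fun s : S => u s.1.1) A B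
  rw [resolventForm_eigenvectors hu hv hA hAu hBv t S (fun s =>
    ((a s.1 - b s.2) / (t * a s.1 + b s.2) : ℝ) * ⟪v s.2, u s.1⟫_ℂ)] at h
  rw [← ENNReal.ofReal_sum_of_nonneg]
  · refine le_trans (le_of_eq ?_) h
    congr 1
    refine Finset.sum_congr rfl fun s _ => ?_
    have h1 : ⟪v s.2, u s.1⟫_ℂ * ⟪u s.1, v s.2⟫_ℂ = ((‖⟪v s.2, u s.1⟫_ℂ‖ ^ 2 : ℝ) : ℂ) := by
      rw [← inner_conj_symm (u s.1) (v s.2), Complex.mul_conj, Complex.normSq_eq_norm_sq]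
    rw [mul_assoc, h1, ← Complex.ofReal_mul, Complex.ofReal_re, norm_mul, Complex.norm_real,
      mul_pow, Real.norm_eq_abs, sq_abs]
    -- When the denominator vanishes, division by zero makes both the coefficient y and the target
    -- term zero.
    rcases eq_or_ne (t * a s.1 + b s.2) 0 with h0 | h0
    · simp [h0]
    · field_simp
      ring
  · intro s _
    have := ha s.1
    have := hb s.2
    positivity

end Orthonormal

/-! ### Equality with the overlap sum in finite dimensions -/

section OrthonormalBasis

variable {I J : Type*} [Fintype I] [Fintype J] {a : I → ℝ} {b : J → ℝ} {A B : H →L[ℂ] H}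

/-- The inner sums are the matrix coefficients ⟨v_j, Y u_i⟩. In these coordinates an arbitrary Y,
not only a diagonal test operator, gives a form that decouples over pairs (i, j). -/
theorem resolventForm_eq_sum (u : OrthonormalBasis I ℂ H) (v : OrthonormalBasis J ℂ H)
    (hA : A.IsSymmetric) (hAu : ∀ i, A (u i) = (a i : ℂ) • u i)
    (hB : B.IsSymmetric) (hBv : ∀ j, B (v j) = (b j : ℂ) • v j) (t : ℝ)
    {κ : Type*} [Fintype κ] (f g : κ → H) :
    resolventForm t f g A B = ∑ i, ∑ j,
      (2 * ((a i - b j) * (⟪u i, v j⟫_ℂ * ∑ s, ⟪v j, f s⟫_ℂ * ⟪g s, u i⟫_ℂ).re) -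
        (t * a i + b j) * ‖∑ s, ⟪v j, f s⟫_ℂ * ⟪g s, u i⟫_ℂ‖ ^ 2) := by
  have eA : ∀ x y, ⟪x, A y⟫_ℂ = ∑ i, (a i : ℂ) * (⟪x, u i⟫_ℂ * ⟪u i, y⟫_ℂ) := by
    intro x y
    rw [← u.sum_inner_mul_inner]
    refine Finset.sum_congr rfl fun i _ => ?_
    have := hA (u i) y
    simp only [ContinuousLinearMap.coe_coe] at this
    rw [← this, hAu, inner_smul_left, Complex.conj_ofReal]
    ring
  have eB : ∀ x y, ⟪x, B y⟫_ℂ = ∑ j, (b j : ℂ) * (⟪x, v j⟫_ℂ * ⟪v j, y⟫_ℂ) := by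
    intro x y
    rw [← v.sum_inner_mul_inner]
    refine Finset.sum_congr rfl fun i _ => ?_
    have := hB (v i) y
    simp only [ContinuousLinearMap.coe_coe] at this
    rw [← this, hBv, inner_smul_left, Complex.conj_ofReal]
    ring
  have e1 : ∑ s, ⟪g s, (A - B) (f s)⟫_ℂ = ∑ i, ∑ j, ((a i - b j : ℝ) : ℂ) *
      (⟪u i, v j⟫_ℂ * ∑ s, ⟪v j, f s⟫_ℂ * ⟪g s, u i⟫_ℂ) := by
    simp only [_root_.sub_apply, inner_sub_right, eA, eB, Finset.mul_sum]
    have h1 : ∀ s, ∑ i, (a i : ℂ) * (⟪g s, u i⟫_ℂ * ⟪u i, f s⟫_ℂ) =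
        ∑ i, ∑ j, (a i : ℂ) * (⟪u i, v j⟫_ℂ * (⟪v j, f s⟫_ℂ * ⟪g s, u i⟫_ℂ)) := by
      intro s
      refine Finset.sum_congr rfl fun i _ => ?_
      rw [← v.sum_inner_mul_inner (u i) (f s), Finset.mul_sum, Finset.mul_sum]
      exact Finset.sum_congr rfl fun j _ => by ring
    have h2 : ∀ s, ∑ j, (b j : ℂ) * (⟪g s, v j⟫_ℂ * ⟪v j, f s⟫_ℂ) =
        ∑ i, ∑ j, (b j : ℂ) * (⟪u i, v j⟫_ℂ * (⟪v j, f s⟫_ℂ * ⟪g s, u i⟫_ℂ)) := by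
      intro s
      rw [Finset.sum_comm]
      refine Finset.sum_congr rfl fun j _ => ?_
      rw [← u.sum_inner_mul_inner (g s) (v j), Finset.sum_mul, Finset.mul_sum]
      exact Finset.sum_congr rfl fun j _ => by ring
    simp only [h1, h2, ← Finset.sum_sub_distrib]
    rw [Finset.sum_comm]
    refine Finset.sum_congr rfl fun i _ => ?_
    rw [Finset.sum_comm]
    refine Finset.sum_congr rfl fun j _ => Finset.sum_congr rfl fun s _ => ?_
    push_cast
    ring
  have e2 : ∀ i j, ((‖∑ s, ⟪v j, f s⟫_ℂ * ⟪g s, u i⟫_ℂ‖ ^ 2 : ℝ) : ℂ) =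
      ∑ s, ∑ r, ⟪f s, v j⟫_ℂ * ⟪u i, g s⟫_ℂ * (⟪v j, f r⟫_ℂ * ⟪g r, u i⟫_ℂ) := by
    intro i j
    rw [← Complex.normSq_eq_norm_sq, Complex.normSq_eq_conj_mul_self, map_sum, Finset.sum_mul_sum]
    simp only [map_mul, inner_conj_symm]
  have e3 : ∑ s, ∑ r, ⟪f s, f r⟫_ℂ * ⟪g r, A (g s)⟫_ℂ =
      ∑ i, ∑ j, (a i : ℂ) * ((‖∑ s, ⟪v j, f s⟫_ℂ * ⟪g s, u i⟫_ℂ‖ ^ 2 : ℝ) : ℂ) := by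
    simp only [e2, eA, Finset.mul_sum]
    have h1 : ∀ s r i, ⟪f s, f r⟫_ℂ * ((a i : ℂ) * (⟪g r, u i⟫_ℂ * ⟪u i, g s⟫_ℂ)) =
        ∑ j, (a i : ℂ) * (⟪f s, v j⟫_ℂ * ⟪u i, g s⟫_ℂ * (⟪v j, f r⟫_ℂ * ⟪g r, u i⟫_ℂ)) := by
      intro s r i
      rw [← v.sum_inner_mul_inner (f s) (f r), Finset.sum_mul]
      exact Finset.sum_congr rfl fun j _ => by ring
    simp only [h1]
    rw [Finset.sum_congr rfl fun s _ => Finset.sum_comm, Finset.sum_comm]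
    refine Finset.sum_congr rfl fun i _ => ?_
    rw [Finset.sum_congr rfl fun s _ => Finset.sum_comm, Finset.sum_comm]
  have e4 : ∑ s, ∑ r, ⟪g s, g r⟫_ℂ * ⟪f r, B (f s)⟫_ℂ =
      ∑ i, ∑ j, (b j : ℂ) * ((‖∑ s, ⟪v j, f s⟫_ℂ * ⟪g s, u i⟫_ℂ‖ ^ 2 : ℝ) : ℂ) := by
    simp only [e2, eB, Finset.mul_sum]
    have h1 : ∀ s r j, ⟪g s, g r⟫_ℂ * ((b j : ℂ) * (⟪f r, v j⟫_ℂ * ⟪v j, f s⟫_ℂ)) =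
        ∑ i, (b j : ℂ) * (⟪f r, v j⟫_ℂ * ⟪u i, g r⟫_ℂ * (⟪v j, f s⟫_ℂ * ⟪g s, u i⟫_ℂ)) := by
      intro s r i
      rw [← u.sum_inner_mul_inner (g s) (g r), Finset.sum_mul]
      exact Finset.sum_congr rfl fun j _ => by ring
    simp only [h1]
    rw [Finset.sum_comm, Finset.sum_congr rfl fun s _ => Finset.sum_congr rfl
      fun s _ => Finset.sum_comm, Finset.sum_congr rfl fun s _ => Finset.sum_comm, Finset.sum_comm]
    refine Finset.sum_congr rfl fun i _ => ?_
    rw [Finset.sum_congr rfl fun s _ => Finset.sum_comm, Finset.sum_comm]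
  have e1' := congrArg Complex.re e1
  have e3' := congrArg Complex.re e3
  have e4' := congrArg Complex.re e4
  simp only [Complex.re_sum, Complex.re_ofReal_mul, Complex.ofReal_re] at e1' e3' e4'
  unfold resolventForm
  simp only [Finset.sum_add_distrib, ← Finset.mul_sum, e1', e3', e4', Finset.sum_sub_distrib,
    add_mul, mul_assoc]

/-- Termwise this is 2xy − wy² ≤ x²/w with w = ta + b. For t > 0, w = 0 forces a = b = 0, so
degenerate pairs contribute nothing. -/
theorem resolventForm_le_sum (u : OrthonormalBasis I ℂ H) (v : OrthonormalBasis J ℂ H)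
    (hA : A.IsSymmetric) (hAu : ∀ i, A (u i) = (a i : ℂ) • u i)
    (hB : B.IsSymmetric) (hBv : ∀ j, B (v j) = (b j : ℂ) • v j)
    (ha : ∀ i, 0 ≤ a i) (hb : ∀ j, 0 ≤ b j) {t : ℝ} (ht : 0 < t)
    {κ : Type*} [Fintype κ] (f g : κ → H) :
    resolventForm t f g A B ≤
      ∑ i, ∑ j, ‖⟪v j, u i⟫_ℂ‖ ^ 2 * ((a i - b j) ^ 2 / (t * a i + b j)) := by
  rw [resolventForm_eq_sum u v hA hAu hB hBv]
  refine Finset.sum_le_sum fun i _ => Finset.sum_le_sum fun j _ => ?_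
  set c := ∑ s, ⟪v j, f s⟫_ℂ * ⟪g s, u i⟫_ℂ
  rw [norm_inner_symm (v j) (u i)]
  have h1 : (a i - b j) * (⟪u i, v j⟫_ℂ * c).re ≤ |a i - b j| * (‖⟪u i, v j⟫_ℂ‖ * ‖c‖) := by
    refine (le_abs_self _).trans ?_
    rw [abs_mul, ← norm_mul]
    exact mul_le_mul_of_nonneg_left (Complex.abs_re_le_norm _) (abs_nonneg _)
  have hai := ha i
  have hbj := hb j
  rcases (by positivity : 0 ≤ t * a i + b j).eq_or_lt with h0 | h0
  · have h2 : t * a i = 0 := by nlinarith [mul_nonneg ht.le hai]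
    have h3 : a i = 0 := by simpa [ht.ne'] using h2
    have h4 : b j = 0 := by linarith
    simp [h3, h4]
  · rw [mul_div_assoc', le_div_iff₀ h0]
    have h5 : (a i - b j) ^ 2 = |a i - b j| ^ 2 := (sq_abs _).symm
    rw [h5]
    nlinarith [sq_nonneg (‖⟪u i, v j⟫_ℂ‖ * |a i - b j| - (t * a i + b j) * ‖c‖),
      mul_le_mul_of_nonneg_right h1 h0.le]

theorem resolventSup_eq_overlapSum (u : OrthonormalBasis I ℂ H) (v : OrthonormalBasis J ℂ H)
    (hA : A.IsSymmetric) (hAu : ∀ i, A (u i) = (a i : ℂ) • u i)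
    (hB : B.IsSymmetric) (hBv : ∀ j, B (v j) = (b j : ℂ) • v j)
    (ha : ∀ i, 0 ≤ a i) (hb : ∀ j, 0 ≤ b j) {t : ℝ} (ht : 0 < t) :
    resolventSup t A B = overlapSum u v a b (fun x y => (x - y) ^ 2 / (t * x + y)) := by
  refine le_antisymm (iSup_le fun m => iSup_le fun f => iSup_le fun g => ?_)
    (overlapSum_le_resolventSup u.orthonormal v.orthonormal hA hAu hBv ha hb ht.le)
  refine (ENNReal.ofReal_le_ofReal
    (resolventForm_le_sum u v hA hAu hB hBv ha hb ht f g)).trans_eq ?_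
  unfold overlapSum
  rw [tsum_fintype, ← Fintype.sum_prod_type' fun i j =>
    ‖⟪v j, u i⟫_ℂ‖ ^ 2 * ((a i - b j) ^ 2 / (t * a i + b j)), ENNReal.ofReal_sum_of_nonneg]
  intro s _
  have := ha s.1
  have := hb s.2
  positivity

end OrthonormalBasis

end Variational

/-! ### Integrating the overlap sums over t -/

section OverlapIntegral

variable {H : Type u} [NormedAddCommGroup H] [InnerProductSpace ℂ H]
variable {I J : Type*} {u : I → H} {v : J → H} {a : I → ℝ} {b : J → ℝ} {A B : H →L[ℂ] H}

theorem measurable_overlapSum [Countable I] [Countable J] :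
    Measurable fun t : ℝ => overlapSum u v a b (fun x y => (x - y) ^ 2 / (t * x + y)) := by
  unfold overlapSum
  exact Measurable.tsum fun s => by fun_prop

/-- Tonelli over the countably many pairs reduces this to `lintegral_resolvent`. The pairs excluded
there, with b = 0 ≠ a, have zero overlap and vanish on both sides. -/
theorem overlapSum_scalarRelEnt_eq_lintegral [Countable I] [Countable J]
    (ha : ∀ i, 0 ≤ a i) (hb : ∀ j, 0 ≤ b j)
    (hab : ∀ i j, b j = 0 → a i ≠ 0 → ⟪v j, u i⟫_ℂ = 0) :
    overlapSum u v a b scalarRelEnt = ∫⁻ t in Ioi (0 : ℝ),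
      overlapSum u v a b (fun x y => (x - y) ^ 2 / (t * x + y)) *
        ENNReal.ofReal ((1 + t) ^ 2)⁻¹ := by
  unfold overlapSum
  simp_rw [← ENNReal.tsum_mul_right]
  rw [lintegral_tsum fun s => by fun_prop]
  refine tsum_congr fun s => ?_
  rw [ENNReal.ofReal_mul (by positivity)]
  have h1 : ∀ t : ℝ, ENNReal.ofReal (‖⟪v s.2, u s.1⟫_ℂ‖ ^ 2 *
      ((a s.1 - b s.2) ^ 2 / (t * a s.1 + b s.2))) * ENNReal.ofReal ((1 + t) ^ 2)⁻¹ =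
      ENNReal.ofReal (‖⟪v s.2, u s.1⟫_ℂ‖ ^ 2) *
        ENNReal.ofReal ((a s.1 - b s.2) ^ 2 / (t * a s.1 + b s.2) / (1 + t) ^ 2) := by
    intro t
    rw [ENNReal.ofReal_mul (by positivity), mul_assoc, ← ENNReal.ofReal_mul' (by positivity),
      div_eq_mul_inv (_ / _)]
  simp_rw [h1]
  rw [lintegral_const_mul _ (by fun_prop)]
  by_cases h : b s.2 = 0 → a s.1 = 0
  · rw [lintegral_resolvent (ha _) (hb _) h]
  · push Not at h
    simp [hab _ _ h.1 h.2]

theorem overlapSum_le_divergence [Countable I] [Countable J]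
    (hu : Orthonormal ℂ u) (hv : Orthonormal ℂ v)
    (hA : A.IsSymmetric) (hAu : ∀ i, A (u i) = (a i : ℂ) • u i)
    (hBv : ∀ j, B (v j) = (b j : ℂ) • v j) (ha : ∀ i, 0 ≤ a i) (hb : ∀ j, 0 ≤ b j)
    (hab : ∀ i j, b j = 0 → a i ≠ 0 → ⟪v j, u i⟫_ℂ = 0) :
    overlapSum u v a b scalarRelEnt ≤ divergence A B := by
  rw [overlapSum_scalarRelEnt_eq_lintegral ha hb hab]
  refine setLIntegral_mono' measurableSet_Ioi fun t ht => ?_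
  gcongr
  exact overlapSum_le_resolventSup hu hv hA hAu hBv ha hb (le_of_lt ht)

/-- Here v_j lies in ker A, which is orthogonal to every eigenvector of the symmetric A with nonzero
eigenvalue. -/
theorem inner_eq_zero_of_ker_le (hA : A.IsSymmetric) (hAu : ∀ i, A (u i) = (a i : ℂ) • u i)
    (hBv : ∀ j, B (v j) = (b j : ℂ) • v j) (hk : ∀ x, B x = 0 → A x = 0) (i : I) (j : J)
    (hj : b j = 0) (hi : a i ≠ 0) : ⟪v j, u i⟫_ℂ = 0 := by
  have h1 : A (v j) = 0 := hk _ (by rw [hBv, hj]; simp)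
  have h2 := hA (v j) (u i)
  simp only [ContinuousLinearMap.coe_coe] at h2
  rw [h1, hAu, inner_zero_left, inner_smul_right] at h2
  exact (mul_eq_zero.1 h2.symm).resolve_left (by exact_mod_cast hi)

end OverlapIntegral

/-! ### Kernels of positive operators -/

section Positive

variable {H : Type u} [NormedAddCommGroup H] [InnerProductSpace ℂ H] [CompleteSpace H]

theorem apply_eq_zero_of_re_inner_eq_zero {A : H →L[ℂ] H} (hA : A.IsPositive) {x : H}
    (hx : (⟪x, A x⟫_ℂ).re = 0) : A x = 0 := by
  have h0 : (0 : H →L[ℂ] H) ≤ A := (ContinuousLinearMap.nonneg_iff_isPositive _).2 hA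
  have hS : (CFC.sqrt A).IsPositive :=
    (ContinuousLinearMap.nonneg_iff_isPositive _).1 (CFC.sqrt_nonneg _)
  have hSS : CFC.sqrt A ∘L CFC.sqrt A = A := CFC.sqrt_mul_sqrt_self _ h0
  have h1 : ⟪x, A x⟫_ℂ = ⟪CFC.sqrt A x, CFC.sqrt A x⟫_ℂ := by
    conv_lhs => rw [← hSS]
    exact (hS.isSymmetric x _).symm
  have h2 : ‖CFC.sqrt A x‖ ^ 2 = 0 := by
    rw [← hx, h1]
    exact (inner_self_eq_norm_sq (𝕜 := ℂ) _).symm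
  have h3 : CFC.sqrt A x = 0 := by simpa using h2
  rw [← hSS, ContinuousLinearMap.comp_apply, h3, map_zero]

theorem apply_eq_zero_of_add_left {A B : H →L[ℂ] H} (hA : A.IsPositive) (hB : B.IsPositive)
    {x : H} (hx : (A + B) x = 0) : A x = 0 := by
  refine apply_eq_zero_of_re_inner_eq_zero hA (le_antisymm ?_ (hA.re_inner_nonneg_right x))
  have h1 : (⟪x, A x⟫_ℂ).re + (⟪x, B x⟫_ℂ).re = 0 := by
    rw [← Complex.add_re, ← inner_add_right, ← _root_.add_apply, hx]
    simp
  have h2 : 0 ≤ (⟪x, B x⟫_ℂ).re := hB.re_inner_nonneg_right x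
  linarith

theorem apply_eq_zero_of_add_right {A B : H →L[ℂ] H} (hA : A.IsPositive) (hB : B.IsPositive)
    {x : H} (hx : (A + B) x = 0) : B x = 0 :=
  apply_eq_zero_of_add_left hB hA (by rwa [add_comm])

end Positive

/-! ### Relative entropy of positive operators on a finite-dimensional space -/

section FiniteDimensional

variable {K : Type u} [NormedAddCommGroup K] [InnerProductSpace ℂ K]

/-- The real part of the trace. -/
def reTrace (T : K →L[ℂ] K) : ℝ := (LinearMap.trace ℂ K T.toLinearMap).re

theorem reTrace_eq_sum {I : Type*} [Fintype I] (e : OrthonormalBasis I ℂ K) (T : K →L[ℂ] K) :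
    reTrace T = ∑ i, (⟪e i, T (e i)⟫_ℂ).re := by
  rw [reTrace, LinearMap.trace_eq_sum_inner _ e, Complex.re_sum]
  rfl

@[simp] theorem reTrace_zero : reTrace (0 : K →L[ℂ] K) = 0 := by simp [reTrace]

theorem reTrace_add (S T : K →L[ℂ] K) : reTrace (S + T) = reTrace S + reTrace T := by
  simp [reTrace]

theorem reTrace_smul (c : ℝ) (T : K →L[ℂ] K) : reTrace ((c : ℂ) • T) = c * reTrace T := by
  simp [reTrace]

theorem reTrace_sub (S T : K →L[ℂ] K) : reTrace (S - T) = reTrace S - reTrace T := by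
  simp [reTrace]

theorem isPositive_smul {A : K →L[ℂ] K} (hA : A.IsPositive) {c : ℝ} (hc : 0 ≤ c) :
    ((c : ℂ) • A).IsPositive := hA.smul_of_nonneg (by exact_mod_cast hc)

section Coordinates

variable {I J : Type*} [Fintype I] [Fintype J] {a : I → ℝ} {b : J → ℝ} {A B : K →L[ℂ] K}

theorem reTrace_eq_sum_eigenvalues (u : OrthonormalBasis I ℂ K)
    (hAu : ∀ i, A (u i) = (a i : ℂ) • u i) : reTrace A = ∑ i, a i := by
  rw [reTrace_eq_sum u]
  refine Finset.sum_congr rfl fun i _ => ?_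
  rw [hAu, inner_smul_right, inner_self_eq_norm_sq_to_K, OrthonormalBasis.norm_eq_one]
  simp

theorem reTrace_comp_eq_sum (u : OrthonormalBasis I ℂ K)
    (hAu : ∀ i, A (u i) = (a i : ℂ) • u i) {L : K →L[ℂ] K} {l : I → ℝ}
    (hL : ∀ i, L (u i) = (l i : ℂ) • u i) : reTrace (A ∘L L) = ∑ i, a i * l i := by
  refine reTrace_eq_sum_eigenvalues u fun i => ?_
  rw [ContinuousLinearMap.comp_apply, hL, map_smul, hAu, smul_smul, mul_comm]
  push_cast
  rfl

theorem reTrace_comp_eq_sum_sum (u : OrthonormalBasis I ℂ K) (v : OrthonormalBasis J ℂ K)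
    (hA : A.IsSymmetric) (hAu : ∀ i, A (u i) = (a i : ℂ) • u i) {L : K →L[ℂ] K} {l : J → ℝ}
    (hL : ∀ j, L (v j) = (l j : ℂ) • v j) :
    reTrace (A ∘L L) = ∑ i, ∑ j, ‖⟪v j, u i⟫_ℂ‖ ^ 2 * (a i * l j) := by
  rw [reTrace_eq_sum v, Finset.sum_comm]
  refine Finset.sum_congr rfl fun j _ => ?_
  rw [ContinuousLinearMap.comp_apply, hL, map_smul, inner_smul_right, Complex.re_ofReal_mul,
    ← u.sum_inner_mul_inner, Complex.re_sum, Finset.mul_sum]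
  refine Finset.sum_congr rfl fun i _ => ?_
  have := hA (u i) (v j)
  simp only [ContinuousLinearMap.coe_coe] at this
  rw [← this, hAu, inner_smul_left, Complex.conj_ofReal, mul_left_comm, Complex.re_ofReal_mul,
    ← inner_conj_symm (u i) (v j), Complex.mul_conj, Complex.ofReal_re, Complex.normSq_eq_norm_sq]
  ring

theorem reTrace_eq_sum_sum_left (u : OrthonormalBasis I ℂ K) (v : OrthonormalBasis J ℂ K)
    (hAu : ∀ i, A (u i) = (a i : ℂ) • u i) :
    reTrace A = ∑ i, ∑ j, ‖⟪v j, u i⟫_ℂ‖ ^ 2 * a i := by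
  rw [reTrace_eq_sum_eigenvalues u hAu]
  refine Finset.sum_congr rfl fun i _ => ?_
  rw [← Finset.sum_mul, v.sum_sq_norm_inner_right, OrthonormalBasis.norm_eq_one]
  simp

theorem reTrace_eq_sum_sum_right (u : OrthonormalBasis I ℂ K) (v : OrthonormalBasis J ℂ K)
    (hBv : ∀ j, B (v j) = (b j : ℂ) • v j) :
    reTrace B = ∑ i, ∑ j, ‖⟪v j, u i⟫_ℂ‖ ^ 2 * b j := by
  rw [reTrace_eq_sum_eigenvalues v hBv, Finset.sum_comm]
  refine Finset.sum_congr rfl fun j _ => ?_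
  rw [← Finset.sum_mul, u.sum_sq_norm_inner_left, OrthonormalBasis.norm_eq_one]
  simp

end Coordinates

variable [FiniteDimensional ℂ K]

theorem continuous_reTrace : Continuous (reTrace : (K →L[ℂ] K) → ℝ) := by
  have h : (reTrace : (K →L[ℂ] K) → ℝ) = fun T => ∑ i,
      (⟪stdOrthonormalBasis ℂ K i, T (stdOrthonormalBasis ℂ K i)⟫_ℂ).re :=
    funext fun T => reTrace_eq_sum _ T
  rw [h]
  fun_prop

theorem hasSum_reTrace_comp {ι : Type*} {p : ι → ℝ} {T : ι → K →L[ℂ] K} {S : K →L[ℂ] K}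
    (h : HasSum (fun i => (p i : ℂ) • T i) S) (L : K →L[ℂ] K) :
    HasSum (fun i => p i * reTrace (T i ∘L L)) (reTrace (S ∘L L)) := by
  have h1 := h.map (AddMonoidHom.mk' (fun T => reTrace (T ∘L L)) fun S T => by
    simp [ContinuousLinearMap.add_comp, reTrace_add]) (by
      change Continuous fun T : K →L[ℂ] K => reTrace (T ∘L L)
      exact continuous_reTrace.comp (by fun_prop))
  refine h1.congr_fun fun i => ?_
  change p i * reTrace (T i ∘L L) = reTrace (((p i : ℂ) • T i) ∘L L)
  rw [ContinuousLinearMap.smul_comp, reTrace_smul]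

theorem exists_eigenvectorBasis {A : K →L[ℂ] K} (hA : A.IsPositive) :
    ∃ (u : OrthonormalBasis (Fin (Module.finrank ℂ K)) ℂ K) (a : Fin (Module.finrank ℂ K) → ℝ),
      (∀ i, 0 ≤ a i) ∧ ∀ i, A (u i) = (a i : ℂ) • u i := by
  refine ⟨hA.isSymmetric.eigenvectorBasis rfl, hA.isSymmetric.eigenvalues rfl, fun i => ?_,
    fun i => hA.isSymmetric.apply_eigenvectorBasis rfl i⟩
  have h := hA.re_inner_nonneg_right (hA.isSymmetric.eigenvectorBasis rfl i)
  have h1 := hA.isSymmetric.apply_eigenvectorBasis rfl i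
  simp only [ContinuousLinearMap.coe_coe] at h1
  rw [h1, inner_smul_right, inner_self_eq_norm_sq_to_K, OrthonormalBasis.norm_eq_one] at h
  simpa using h

open Classical in
/-- The logarithm of a symmetric operator (zero on its kernel). -/
def logOp (A : K →L[ℂ] K) : K →L[ℂ] K :=
  if h : A.IsSymmetric then
    ∑ i, (Real.log (h.eigenvalues rfl i) : ℂ) •
      (innerSL ℂ (h.eigenvectorBasis rfl i)).smulRight (h.eigenvectorBasis rfl i)
  else 0

/-- An eigenvector has components only along basis vectors with the same eigenvalue. Hence the
eigenbasis chosen in `logOp` is immaterial, and traces can be computed in any convenient one. -/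
theorem logOp_apply_eigenvector {A : K →L[ℂ] K} (hA : A.IsSymmetric) {x : K} {c : ℝ}
    (hx : A x = (c : ℂ) • x) : logOp A x = (Real.log c : ℂ) • x := by
  rw [logOp, dif_pos hA]
  conv_rhs => rw [← (hA.eigenvectorBasis rfl).sum_repr' x]
  rw [_root_.sum_apply, Finset.smul_sum]
  refine Finset.sum_congr rfl fun i _ => ?_
  simp only [_root_.smul_apply, ContinuousLinearMap.smulRight_apply, innerSL_apply_apply]
  rcases eq_or_ne ⟪hA.eigenvectorBasis rfl i, x⟫_ℂ 0 with h | h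
  · simp [h]
  · have h1 := hA (hA.eigenvectorBasis rfl i) x
    rw [hA.apply_eigenvectorBasis] at h1
    simp only [ContinuousLinearMap.coe_coe] at h1
    rw [hx, inner_smul_left, inner_smul_right] at h1
    have h2 := mul_right_cancel₀ h h1
    have h3 : hA.eigenvalues rfl i = c :=
      Complex.ofReal_injective ((Complex.conj_ofReal _).symm.trans h2)
    rw [h3]

/-- The relative entropy `Tr A log A - Tr A log B` of positive operators with `ker B ≤ ker A`. -/
def relEnt (A B : K →L[ℂ] K) : ℝ := reTrace (A ∘L logOp A) - reTrace (A ∘L logOp B)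

section Coordinates

variable {I J : Type*} [Fintype I] [Fintype J] {a : I → ℝ} {b : J → ℝ} {A B : K →L[ℂ] K}

theorem relEnt_eq_sum (u : OrthonormalBasis I ℂ K) (v : OrthonormalBasis J ℂ K)
    (hA : A.IsSymmetric) (hAu : ∀ i, A (u i) = (a i : ℂ) • u i)
    (hB : B.IsSymmetric) (hBv : ∀ j, B (v j) = (b j : ℂ) • v j) :
    relEnt A B = ∑ i, ∑ j, ‖⟪v j, u i⟫_ℂ‖ ^ 2 *
      (a i * Real.log (a i) - a i * Real.log (b j)) := by
  rw [relEnt, reTrace_comp_eq_sum u hAu (fun i => logOp_apply_eigenvector hA (hAu i)),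
    reTrace_comp_eq_sum_sum u v hA hAu (fun j => logOp_apply_eigenvector hB (hBv j)),
    ← Finset.sum_sub_distrib]
  refine Finset.sum_congr rfl fun i _ => ?_
  simp_rw [mul_sub]
  rw [Finset.sum_sub_distrib, ← Finset.sum_mul, v.sum_sq_norm_inner_right,
    OrthonormalBasis.norm_eq_one]
  simp

end Coordinates

variable {A B C : K →L[ℂ] K}

/-- The difference of the two sides is a sum of overlaps times `scalarRelEnt (a i) (s * b j)`, each
nonnegative. The scale s is left free: s = 1 gives nonnegativity of the divergence, the optimal s
Klein's inequality. -/
theorem mul_log_add_le_relEnt (hA : A.IsPositive) (hB : B.IsPositive)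
    (hk : ∀ x, B x = 0 → A x = 0) {s : ℝ} (hs : 0 < s) :
    reTrace A * Real.log s + reTrace A - s * reTrace B ≤ relEnt A B := by
  obtain ⟨u, a, ha, hAu⟩ := exists_eigenvectorBasis hA
  obtain ⟨v, b, hb, hBv⟩ := exists_eigenvectorBasis hB
  rw [relEnt_eq_sum u v hA.isSymmetric hAu hB.isSymmetric hBv, reTrace_eq_sum_sum_left u v hAu,
    reTrace_eq_sum_sum_right u v hBv, Finset.sum_mul, Finset.mul_sum, ← Finset.sum_add_distrib,
    ← Finset.sum_sub_distrib]
  refine Finset.sum_le_sum fun i _ => ?_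
  rw [Finset.sum_mul, Finset.mul_sum, ← Finset.sum_add_distrib, ← Finset.sum_sub_distrib]
  refine Finset.sum_le_sum fun j _ => ?_
  by_cases h : b j = 0 → a i = 0
  · have h1 : 0 ≤ scalarRelEnt (a i) (s * b j) := scalarRelEnt_nonneg (ha i)
      (mul_nonneg hs.le (hb j)) fun h' => h ((mul_eq_zero.1 h').resolve_left hs.ne')
    have h2 : a i * Real.log (s * b j) = a i * (Real.log s + Real.log (b j)) := by
      rcases eq_or_ne (b j) 0 with h0 | h0
      · simp [h h0]
      · rw [Real.log_mul hs.ne' h0]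
    unfold scalarRelEnt at h1
    rw [h2] at h1
    have h3 := mul_nonneg (sq_nonneg ‖⟪v j, u i⟫_ℂ‖) h1
    linarith
  · push Not at h
    simp [inner_eq_zero_of_ker_le hA.isSymmetric hAu hBv hk i j h.1 h.2]

theorem reTrace_nonneg (hA : A.IsPositive) : 0 ≤ reTrace A := by
  rw [reTrace_eq_sum (stdOrthonormalBasis ℂ K)]
  exact Finset.sum_nonneg fun i _ => hA.re_inner_nonneg_right _

/-- Klein's inequality for operators of arbitrary traces. -/
theorem mul_log_sub_log_le_relEnt (hA : A.IsPositive) (hB : B.IsPositive)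
    (hk : ∀ x, B x = 0 → A x = 0) :
    reTrace A * (Real.log (reTrace A) - Real.log (reTrace B)) ≤ relEnt A B := by
  rcases (reTrace_nonneg hA).eq_or_lt with h0 | h0
  · rw [← h0, zero_mul]
    obtain ⟨u, a, ha, hAu⟩ := exists_eigenvectorBasis hA
    have h1 := reTrace_eq_sum_eigenvalues u hAu
    rw [← h0, eq_comm, Finset.sum_eq_zero_iff_of_nonneg fun i _ => ha i] at h1
    obtain ⟨v, b, hb, hBv⟩ := exists_eigenvectorBasis hB
    rw [relEnt_eq_sum u v hA.isSymmetric hAu hB.isSymmetric hBv]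
    simp [h1 _ (Finset.mem_univ _)]
  · have hB0 : 0 < reTrace B := by
      refine (reTrace_nonneg hB).lt_of_ne fun h => ?_
      obtain ⟨v, b, hb, hBv⟩ := exists_eigenvectorBasis hB
      have h1 := reTrace_eq_sum_eigenvalues v hBv
      rw [← h, eq_comm, Finset.sum_eq_zero_iff_of_nonneg fun i _ => hb i] at h1
      have h2 : reTrace A = 0 := by
        rw [reTrace_eq_sum v]
        refine Finset.sum_eq_zero fun j _ => ?_
        rw [hk (v j) (by rw [hBv, h1 j (Finset.mem_univ _)]; simp)]
        simp
      exact h0.ne' h2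
    -- The left-hand side is maximal at s = Tr A / Tr B.
    have h1 := mul_log_add_le_relEnt hA hB hk (div_pos h0 hB0)
    rw [Real.log_div h0.ne' hB0.ne', div_mul_cancel₀ _ hB0.ne'] at h1
    linarith

theorem relEnt_sub_add_nonneg (hA : A.IsPositive) (hB : B.IsPositive)
    (hk : ∀ x, B x = 0 → A x = 0) : 0 ≤ relEnt A B - reTrace A + reTrace B := by
  have := mul_log_add_le_relEnt hA hB hk one_pos
  rw [Real.log_one] at this
  linarith

/-- Kernel inclusion is essential: without it the integral can be infinite, while `relEnt`, whose
logarithm is zero on the kernel, is always finite. -/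
theorem divergence_eq_relEnt (hA : A.IsPositive) (hB : B.IsPositive)
    (hk : ∀ x, B x = 0 → A x = 0) :
    divergence A B = ENNReal.ofReal (relEnt A B - reTrace A + reTrace B) := by
  obtain ⟨u, a, ha, hAu⟩ := exists_eigenvectorBasis hA
  obtain ⟨v, b, hb, hBv⟩ := exists_eigenvectorBasis hB
  have hw := inner_eq_zero_of_ker_le hA.isSymmetric hAu hBv hk
  have h1 : divergence A B = overlapSum u v a b scalarRelEnt := by
    rw [overlapSum_scalarRelEnt_eq_lintegral ha hb hw]
    refine setLIntegral_congr_fun measurableSet_Ioi fun t ht => ?_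
    rw [resolventSup_eq_overlapSum u v hA.isSymmetric hAu hB.isSymmetric hBv ha hb ht]
  rw [h1, overlapSum, tsum_fintype, ← ENNReal.ofReal_sum_of_nonneg, Fintype.sum_prod_type,
    relEnt_eq_sum u v hA.isSymmetric hAu hB.isSymmetric hBv, reTrace_eq_sum_sum_left u v hAu,
    reTrace_eq_sum_sum_right u v hBv, ← Finset.sum_sub_distrib, ← Finset.sum_add_distrib]
  · congr 1
    refine Finset.sum_congr rfl fun i _ => ?_
    rw [← Finset.sum_sub_distrib, ← Finset.sum_add_distrib]
    refine Finset.sum_congr rfl fun j _ => ?_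
    unfold scalarRelEnt
    ring
  · intro s _
    by_cases h : b s.2 = 0 → a s.1 = 0
    · exact mul_nonneg (sq_nonneg _) (scalarRelEnt_nonneg (ha _) (hb _) h)
    · push Not at h
      simp [hw s.1 s.2 h.1 h.2]

/-- A supremum over uncountably many test operators is not evidently measurable in t; for t > 0 it
equals a finite sum of explicit functions. -/
theorem aemeasurable_resolventSup (hA : A.IsPositive) (hB : B.IsPositive) :
    AEMeasurable (fun t : ℝ => resolventSup t A B) (volume.restrict (Ioi 0)) := by
  obtain ⟨u, a, ha, hAu⟩ := exists_eigenvectorBasis hA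
  obtain ⟨v, b, hb, hBv⟩ := exists_eigenvectorBasis hB
  refine ⟨_, measurable_overlapSum (u := u) (v := v) (a := a) (b := b), ?_⟩
  refine (ae_restrict_iff' measurableSet_Ioi).2 (Eventually.of_forall fun t ht => ?_)
  exact resolventSup_eq_overlapSum u v hA.isSymmetric hAu hB.isSymmetric hBv ha hb ht

theorem divergence_add_le {A₁ A₂ B₁ B₂ : K →L[ℂ] K} (hA : A₁.IsPositive) (hB : B₁.IsPositive) :
    divergence (A₁ + A₂) (B₁ + B₂) ≤ divergence A₁ B₁ + divergence A₂ B₂ := by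
  unfold divergence
  have hm : AEMeasurable (fun t : ℝ => resolventSup t A₁ B₁ * ENNReal.ofReal ((1 + t) ^ 2)⁻¹)
      (volume.restrict (Ioi 0)) := (aemeasurable_resolventSup hA hB).mul (by fun_prop)
  rw [← lintegral_add_left' hm]
  refine lintegral_mono fun t => ?_
  rw [← add_mul]
  gcongr
  exact resolventSup_add_le t A₁ A₂ B₁ B₂

/-- Joint subadditivity (equivalently, joint convexity) of the relative entropy. -/
theorem relEnt_add_le {A₁ A₂ B₁ B₂ : K →L[ℂ] K} (hA₁ : A₁.IsPositive) (hB₁ : B₁.IsPositive)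
    (hA₂ : A₂.IsPositive) (hB₂ : B₂.IsPositive) (hk₁ : ∀ x, B₁ x = 0 → A₁ x = 0)
    (hk₂ : ∀ x, B₂ x = 0 → A₂ x = 0) :
    relEnt (A₁ + A₂) (B₁ + B₂) ≤ relEnt A₁ B₁ + relEnt A₂ B₂ := by
  have h := divergence_add_le (A₂ := A₂) (B₂ := B₂) hA₁ hB₁
  have hk : ∀ x, (B₁ + B₂) x = 0 → (A₁ + A₂) x = 0 := fun x hx => by
    rw [_root_.add_apply, hk₁ x (apply_eq_zero_of_add_left hB₁ hB₂ hx),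
      hk₂ x (apply_eq_zero_of_add_right hB₁ hB₂ hx), add_zero]
  have n1 := relEnt_sub_add_nonneg hA₁ hB₁ hk₁
  have n2 := relEnt_sub_add_nonneg hA₂ hB₂ hk₂
  rw [divergence_eq_relEnt hA₁ hB₁ hk₁, divergence_eq_relEnt hA₂ hB₂ hk₂,
    divergence_eq_relEnt (hA₁.add hA₂) (hB₁.add hB₂) hk, ← ENNReal.ofReal_add n1 n2,
    ENNReal.ofReal_le_ofReal_iff (add_nonneg n1 n2), reTrace_add, reTrace_add] at h
  linarith

theorem relEnt_self (A : K →L[ℂ] K) : relEnt A A = 0 := sub_self _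

theorem relEnt_zero_left (B : K →L[ℂ] K) : relEnt 0 B = 0 := by simp [relEnt]

/-- Joint subadditivity applied to (A, B) and (0, C). -/
theorem relEnt_add_right_le (hA : A.IsPositive) (hB : B.IsPositive) (hC : C.IsPositive)
    (hk : ∀ x, B x = 0 → A x = 0) : relEnt A (B + C) ≤ relEnt A B := by
  have h := relEnt_add_le hA hB ContinuousLinearMap.isPositive_zero hC hk (fun _ _ => rfl)
  rwa [add_zero, relEnt_zero_left, add_zero] at h

/-- The terms with log C cancel by linearity, and the remaining gap is −D(A‖A + B) − D(B‖A + B).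
Both entropies are at most D(A‖A) = D(B‖B) = 0 by monotonicity in the second argument. -/
theorem relEnt_add_relEnt_le (hA : A.IsPositive) (hB : B.IsPositive) :
    relEnt A C + relEnt B C ≤ relEnt (A + B) C := by
  have h1 : relEnt A (A + B) ≤ 0 :=
    (relEnt_add_right_le hA hA hB fun _ h => h).trans_eq (relEnt_self A)
  have h2 : relEnt B (A + B) ≤ 0 := by
    rw [add_comm]
    exact (relEnt_add_right_le hB hB hA fun _ h => h).trans_eq (relEnt_self B)
  unfold relEnt at *
  rw [ContinuousLinearMap.add_comp, ContinuousLinearMap.add_comp, reTrace_add, reTrace_add]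
  linarith

theorem relEnt_smul_self (hA : A.IsPositive) {c : ℝ} (hc : 0 < c) :
    relEnt A ((c : ℂ) • A) = -(reTrace A * Real.log c) := by
  obtain ⟨u, a, ha, hAu⟩ := exists_eigenvectorBasis hA
  have h1 : ∀ i, ((c : ℂ) • A) (u i) = ((c * a i : ℝ) : ℂ) • u i := fun i => by
    rw [_root_.smul_apply, hAu, smul_smul, Complex.ofReal_mul]
  rw [relEnt, reTrace_comp_eq_sum u hAu fun i => logOp_apply_eigenvector hA.isSymmetric (hAu i),
    reTrace_comp_eq_sum u hAu fun i =>
      logOp_apply_eigenvector (isPositive_smul hA hc.le).isSymmetric (h1 i),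
    reTrace_eq_sum_eigenvalues u hAu, Finset.sum_mul, ← Finset.sum_sub_distrib,
    ← Finset.sum_neg_distrib]
  refine Finset.sum_congr rfl fun i _ => ?_
  rcases eq_or_ne (a i) 0 with h0 | h0
  · simp [h0]
  · rw [Real.log_mul hc.ne' h0]
    ring

/-- The operators commute, and every eigenvalue of A is at most Tr A. -/
theorem relEnt_smul_one_le (hA : A.IsPositive) {c : ℝ} (hc : 0 ≤ c) :
    relEnt A ((c : ℂ) • 1) ≤ reTrace A * (Real.log (reTrace A) - Real.log c) := by
  obtain ⟨u, a, ha, hAu⟩ := exists_eigenvectorBasis hA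
  have hone : (1 : K →L[ℂ] K).IsPositive := ContinuousLinearMap.isPositive_one
  have h1 : ∀ i, ((c : ℂ) • (1 : K →L[ℂ] K)) (u i) = (c : ℂ) • u i := fun i => by simp
  rw [relEnt, reTrace_comp_eq_sum u hAu fun i => logOp_apply_eigenvector hA.isSymmetric (hAu i),
    reTrace_comp_eq_sum u hAu fun i =>
      logOp_apply_eigenvector (isPositive_smul hone hc).isSymmetric (h1 i),
    reTrace_eq_sum_eigenvalues u hAu, Finset.sum_mul, ← Finset.sum_sub_distrib]
  refine Finset.sum_le_sum fun i _ => ?_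
  rw [← mul_sub]
  rcases (ha i).eq_or_lt with h0 | h0
  · simp [← h0]
  · gcongr
    exact Finset.single_le_sum (fun i _ => ha i) (Finset.mem_univ i)

end FiniteDimensional

/-! ### The main estimate in finite dimensions -/

section FiniteDimensionalBound

variable {K : Type u} [NormedAddCommGroup K] [InnerProductSpace ℂ K] [FiniteDimensional ℂ K]

/-- With ω = σ + Δ: D(ρ‖ω) + D(N‖ω) ≤ D(ρ + N‖ω) = D(σ + P‖σ + Δ) ≤ D(σ‖σ) + D(P‖Δ), and D(N‖ω) is
bounded below by Klein's inequality. Traces stay general because compressed states need not have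
trace one. -/
theorem relEnt_le_of_add_eq_add {ρ σ P N Δ : K →L[ℂ] K} (hρ : ρ.IsPositive) (hσ : σ.IsPositive)
    (hP : P.IsPositive) (hN : N.IsPositive) (hΔ : Δ.IsPositive) (h : ρ + N = σ + P)
    (hk : ∀ x, Δ x = 0 → P x = 0) :
    relEnt ρ (σ + Δ) ≤ relEnt P Δ -
      reTrace N * (Real.log (reTrace N) - Real.log (reTrace σ + reTrace Δ)) := by
  have hkN : ∀ x, (σ + Δ) x = 0 → N x = 0 := fun x hx => by
    refine apply_eq_zero_of_add_right hρ hN ?_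
    rw [h, _root_.add_apply, apply_eq_zero_of_add_left hσ hΔ hx,
      hk x (apply_eq_zero_of_add_right hσ hΔ hx), add_zero]
  have h1 := relEnt_add_relEnt_le (C := σ + Δ) hρ hN
  have h2 := relEnt_add_le hσ hσ hP hΔ (fun _ h => h) hk
  have h3 := mul_log_sub_log_le_relEnt hN (hσ.add hΔ) hkN
  rw [h] at h1
  rw [relEnt_self] at h2
  rw [reTrace_add] at h3
  linarith

theorem isPositive_of_hasSum {ι : Type*} {p : ι → ℝ} (hp : ∀ i, 0 ≤ p i) {T : ι → K →L[ℂ] K}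
    (hT : ∀ i, (T i).IsPositive) {S : K →L[ℂ] K} (h : HasSum (fun i => (p i : ℂ) • T i) S) :
    S.IsPositive := by
  rw [← ContinuousLinearMap.nonneg_iff_isPositive]
  refine h.nonneg fun i => ?_
  rw [ContinuousLinearMap.nonneg_iff_isPositive]
  exact isPositive_smul (hT i) (hp i)

theorem apply_eq_zero_of_hasSum {ι : Type*} {p : ι → ℝ} (hp : ∀ i, 0 ≤ p i) {T : ι → K →L[ℂ] K}
    (hT : ∀ i, (T i).IsPositive) {S : K →L[ℂ] K} (h : HasSum (fun i => (p i : ℂ) • T i) S)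
    {i : ι} (hi : 0 < p i) {x : K} (hx : S x = 0) : T i x = 0 := by
  have h1 : (p i : ℂ) • T i ≤ S := le_hasSum h i fun j _ => by
    rw [ContinuousLinearMap.nonneg_iff_isPositive]
    exact isPositive_smul (hT j) (hp j)
  have h2 : (S - (p i : ℂ) • T i).IsPositive := h1
  have h3 := apply_eq_zero_of_add_left (isPositive_smul (hT i) (hp i)) h2 (x := x)
    (by simpa using hx)
  rw [_root_.smul_apply, smul_eq_zero] at h3
  exact h3.resolve_left (by exact_mod_cast hi.ne')

/-- Donald's identity trades the reference τ for ω = σ + Δ at the cost of −D(τ‖ω), which Klein's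
inequality controls. The numbers c_i keep open how D(P_i‖Δ) is estimated. -/
theorem tsum_divergence_le {ι : Type*} {p : ι → ℝ} (hp : ∀ i, 0 ≤ p i) (hp1 : HasSum p 1)
    {ρ P N : ι → K →L[ℂ] K} {σ Δ τ : K →L[ℂ] K} (hρ : ∀ i, (ρ i).IsPositive)
    (hP : ∀ i, (P i).IsPositive) (hN : ∀ i, (N i).IsPositive) (hσ : σ.IsPositive)
    (hΔ : Δ.IsPositive) (hτ : HasSum (fun i => (p i : ℂ) • ρ i) τ)
    (h : ∀ i, ρ i + N i = σ + P i) (hk : ∀ i, 0 < p i → ∀ x, Δ x = 0 → P i x = 0)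
    {c : ι → ℝ} (hc : ∀ i, 0 < p i →
      relEnt (P i) Δ - reTrace (N i) * Real.log (reTrace (N i)) ≤ c i)
    {C e : ℝ} (hC : HasSum (fun i => p i * c i) C)
    (he : HasSum (fun i => p i * reTrace (N i)) e) :
    ∑' i, ENNReal.ofReal (p i) * divergence (ρ i) τ ≤
      ENNReal.ofReal (C + e * Real.log (reTrace σ + reTrace Δ) -
        reTrace τ * (Real.log (reTrace τ) - Real.log (reTrace σ + reTrace Δ))) := by
  set w := reTrace σ + reTrace Δ with hw
  have hτp : τ.IsPositive := isPositive_of_hasSum hp hρ hτ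
  have hkτ : ∀ i, 0 < p i → ∀ x, τ x = 0 → ρ i x = 0 := fun i hi x hx =>
    apply_eq_zero_of_hasSum hp hρ hτ hi hx
  have hkω : ∀ x, (σ + Δ) x = 0 → τ x = 0 := fun x hx => by
    have h1 := hτ.mapL (ContinuousLinearMap.apply ℂ K x)
    refine h1.unique ?_
    have h2 : (fun i => ContinuousLinearMap.apply ℂ K x ((p i : ℂ) • ρ i)) = fun _ => (0 : K) := by
      funext i
      rcases (hp i).eq_or_lt with h0 | h0
      · simp [← h0]
      · have : ρ i x = 0 := by
          refine apply_eq_zero_of_add_left (hρ i) (hN i) ?_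
          rw [h, _root_.add_apply, apply_eq_zero_of_add_left hσ hΔ hx,
            hk i h0 x (apply_eq_zero_of_add_right hσ hΔ hx), add_zero]
        simp [this]
    rw [h2]
    exact hasSum_zero
  -- D(ρ_i‖τ) = D(ρ_i‖ω) − Tr ρ_i L, and the correction is linear in ρ_i, so it averages to Tr τ L =
  -- D(τ‖ω).
  set L := logOp τ - logOp (σ + Δ) with hL
  have hLτ : reTrace (τ ∘L L) = relEnt τ (σ + Δ) := by
    rw [hL, ContinuousLinearMap.comp_sub, reTrace_sub, relEnt]
  have hs1 := hasSum_reTrace_comp hτ L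
  have hs2 := hasSum_reTrace_comp hτ (ContinuousLinearMap.id ℂ K)
  simp only [ContinuousLinearMap.comp_id] at hs2
  -- The terms −Tr ρ_i + Tr τ, present in `divergence`, average to zero.
  have hsum := (((hC.add (he.mul_right (Real.log w))).sub hs1).sub hs2).add
    (hp1.mul_right (reTrace τ))
  rw [hLτ, one_mul, sub_add_cancel] at hsum
  have key : ∀ i, ENNReal.ofReal (p i) * divergence (ρ i) τ ≤
      ENNReal.ofReal (p i * c i + p i * reTrace (N i) * Real.log w - p i * reTrace (ρ i ∘L L) -
        p i * reTrace (ρ i) + p i * reTrace τ) ∧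
      0 ≤ p i * c i + p i * reTrace (N i) * Real.log w - p i * reTrace (ρ i ∘L L) -
        p i * reTrace (ρ i) + p i * reTrace τ := by
    intro i
    rcases (hp i).eq_or_lt with h0 | h0
    · simp [← h0]
    · have h1 := relEnt_le_of_add_eq_add (hρ i) hσ (hP i) (hN i) hΔ (h i) (hk i h0)
      have h2 : relEnt (ρ i) τ = relEnt (ρ i) (σ + Δ) - reTrace (ρ i ∘L L) := by
        rw [hL, ContinuousLinearMap.comp_sub, reTrace_sub, relEnt, relEnt]
        ring
      have h3 := relEnt_sub_add_nonneg (hρ i) hτp (hkτ i h0)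
      have h4 : p i * (relEnt (ρ i) τ - reTrace (ρ i) + reTrace τ) ≤
          p i * c i + p i * reTrace (N i) * Real.log w - p i * reTrace (ρ i ∘L L) -
            p i * reTrace (ρ i) + p i * reTrace τ := by
        have h5 : relEnt (ρ i) τ - reTrace (ρ i) + reTrace τ ≤ c i + reTrace (N i) * Real.log w -
            reTrace (ρ i ∘L L) - reTrace (ρ i) + reTrace τ := by
          have := hc i h0
          linarith
        refine (mul_le_mul_of_nonneg_left h5 (hp i)).trans_eq ?_
        ring
      refine ⟨?_, (mul_nonneg (hp i) h3).trans h4⟩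
      rw [divergence_eq_relEnt (hρ i) hτp (hkτ i h0), ← ENNReal.ofReal_mul (hp i)]
      exact ENNReal.ofReal_le_ofReal h4
  refine (ENNReal.tsum_le_tsum fun i => (key i).1).trans ?_
  rw [← ENNReal.ofReal_tsum_of_nonneg (fun i => (key i).2) hsum.summable, hsum.tsum_eq]
  refine ENNReal.ofReal_le_ofReal ?_
  have := mul_log_sub_log_le_relEnt hτp (hσ.add hΔ) hkω
  rw [reTrace_add] at this
  linarith

end FiniteDimensionalBound

/-! ### Compressions to finite-dimensional subspaces -/

section Compression

variable {H : Type u} [NormedAddCommGroup H] [InnerProductSpace ℂ H] [CompleteSpace H]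

/-- The isometry `ℂ^F → H` onto the span of finitely many vectors of the reference basis. -/
def finEmbed (F : Finset (refIndex H)) : EuclideanSpace ℂ F →L[ℂ] H :=
  ∑ i : F, (EuclideanSpace.proj i : EuclideanSpace ℂ F →L[ℂ] ℂ).smulRight (refBasis H i)

/-- The compression of an operator to the span of finitely many vectors of the reference basis. -/
def compress (F : Finset (refIndex H)) (A : H →L[ℂ] H) :
    EuclideanSpace ℂ F →L[ℂ] EuclideanSpace ℂ F :=
  ContinuousLinearMap.adjoint (finEmbed F) ∘L A ∘L finEmbed F

theorem finEmbed_single [DecidableEq (refIndex H)] (F : Finset (refIndex H)) (i : F) :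
    finEmbed F (EuclideanSpace.single i 1) = refBasis H i := by
  simp [finEmbed]

theorem inner_compress (F : Finset (refIndex H)) (A : H →L[ℂ] H) (x y : EuclideanSpace ℂ F) :
    ⟪x, compress F A y⟫_ℂ = ⟪finEmbed F x, A (finEmbed F y)⟫_ℂ := by
  simp [compress, ContinuousLinearMap.adjoint_inner_right]

theorem finEmbed_adjoint_apply (F : Finset (refIndex H)) (x : H) (i : F) :
    ContinuousLinearMap.adjoint (finEmbed F) x i = ⟪refBasis H i, x⟫_ℂ := by
  classical
  rw [← finEmbed_single F i, ← ContinuousLinearMap.adjoint_inner_right,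
    EuclideanSpace.inner_single_left]
  simp

theorem finEmbed_adjoint (F : Finset (refIndex H)) (x : H) :
    finEmbed F (ContinuousLinearMap.adjoint (finEmbed F) x) =
      ∑ i ∈ F, ⟪refBasis H i, x⟫_ℂ • refBasis H i := by
  rw [← Finset.sum_coe_sort F]
  conv_lhs => rw [finEmbed]
  rw [_root_.sum_apply]
  refine Finset.sum_congr rfl fun i _ => ?_
  rw [ContinuousLinearMap.smulRight_apply]
  congr 1
  exact finEmbed_adjoint_apply F x i

theorem tendsto_finEmbed_adjoint (x : H) :
    Tendsto (fun F : Finset (refIndex H) => finEmbed F (ContinuousLinearMap.adjoint (finEmbed F) x))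
      atTop (𝓝 x) := by
  simp_rw [finEmbed_adjoint]
  have := (refBasis H).hasSum_repr x
  simp_rw [HilbertBasis.repr_apply_apply] at this
  exact this

theorem reTrace_compress (F : Finset (refIndex H)) (A : H →L[ℂ] H) :
    reTrace (compress F A) = ∑ i ∈ F, (⟪refBasis H i, A (refBasis H i)⟫_ℂ).re := by
  classical
  rw [reTrace_eq_sum (EuclideanSpace.basisFun F ℂ), ← Finset.sum_coe_sort F]
  refine Finset.sum_congr rfl fun i _ => ?_
  rw [EuclideanSpace.basisFun_apply, inner_compress, finEmbed_single]

theorem isPositive_compress {A : H →L[ℂ] H} (hA : A.IsPositive) (F : Finset (refIndex H)) :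
    (compress F A).IsPositive := hA.adjoint_conj _

theorem compress_add (F : Finset (refIndex H)) (A B : H →L[ℂ] H) :
    compress F (A + B) = compress F A + compress F B := by
  simp [compress, ContinuousLinearMap.add_comp, ContinuousLinearMap.comp_add]

theorem compress_smul (F : Finset (refIndex H)) (c : ℂ) (A : H →L[ℂ] H) :
    compress F (c • A) = c • compress F A := by
  simp [compress, ContinuousLinearMap.smul_comp]

theorem hasSum_compress {ι : Type*} {p : ι → ℝ} {T : ι → H →L[ℂ] H} {S : H →L[ℂ] H}
    (h : HasSum (fun i => (p i : ℂ) • T i) S) (F : Finset (refIndex H)) :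
    HasSum (fun i => (p i : ℂ) • compress F (T i)) (compress F S) := by
  have h1 := h.map (AddMonoidHom.mk' (compress F) (compress_add F)) (by
    change Continuous (compress F)
    unfold compress
    fun_prop)
  refine h1.congr_fun fun i => ?_
  exact (compress_smul F _ _).symm

theorem tendsto_inner_compress (A : H →L[ℂ] H) (x y : H) :
    Tendsto (fun F : Finset (refIndex H) => ⟪ContinuousLinearMap.adjoint (finEmbed F) x,
      compress F A (ContinuousLinearMap.adjoint (finEmbed F) y)⟫_ℂ) atTop (𝓝 ⟪x, A y⟫_ℂ) := by
  simp_rw [inner_compress]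
  exact (tendsto_finEmbed_adjoint x).inner
    ((A.continuous.tendsto y).comp (tendsto_finEmbed_adjoint y))

theorem tendsto_inner_adjoint (x y : H) :
    Tendsto (fun F : Finset (refIndex H) => ⟪ContinuousLinearMap.adjoint (finEmbed F) x,
      ContinuousLinearMap.adjoint (finEmbed F) y⟫_ℂ) atTop (𝓝 ⟪x, y⟫_ℂ) := by
  simp_rw [ContinuousLinearMap.adjoint_inner_right]
  exact (tendsto_finEmbed_adjoint x).inner tendsto_const_nhds

/-- The form involves finitely many inner products, each converging because the projections onto
spans of basis vectors tend strongly to the identity. Nothing is asked of A and B beyond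
boundedness. -/
theorem tendsto_resolventForm_compress {κ : Type*} [Fintype κ] (t : ℝ) (f g : κ → H)
    (A B : H →L[ℂ] H) : Tendsto (fun F : Finset (refIndex H) => resolventForm t
      (fun s => ContinuousLinearMap.adjoint (finEmbed F) (f s))
      (fun s => ContinuousLinearMap.adjoint (finEmbed F) (g s)) (compress F A) (compress F B))
      atTop (𝓝 (resolventForm t f g A B)) := by
  unfold resolventForm
  simp only [_root_.sub_apply, inner_sub_right]
  refine Tendsto.sub (tendsto_finsetSum _ fun s _ => ?_)
    (tendsto_finsetSum _ fun s _ => tendsto_finsetSum _ fun r _ => Tendsto.add ?_ ?_)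
  · exact ((Complex.continuous_re.tendsto _).comp
      ((tendsto_inner_compress A _ _).sub (tendsto_inner_compress B _ _))).const_mul 2
  · exact ((Complex.continuous_re.tendsto _).comp
      ((tendsto_inner_adjoint _ _).mul (tendsto_inner_compress A _ _))).const_mul t
  · exact (Complex.continuous_re.tendsto _).comp
      ((tendsto_inner_adjoint _ _).mul (tendsto_inner_compress B _ _))

theorem resolventSup_le_liminf_compress (t : ℝ) (A B : H →L[ℂ] H) :
    resolventSup t A B ≤ liminf (fun F : Finset (refIndex H) =>
      resolventSup t (compress F A) (compress F B)) atTop := by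
  refine iSup_le fun m => iSup_le fun f => iSup_le fun g => ?_
  have h := (ENNReal.continuous_ofReal.tendsto _).comp (tendsto_resolventForm_compress t f g A B)
  rw [← h.liminf_eq]
  exact liminf_le_liminf (Eventually.of_forall fun F => resolventForm_le_resolventSup _ _ _ _ _)

/-- Lower semicontinuity of the relative entropy along compressions. -/
theorem divergence_le_liminf_compress [Countable (refIndex H)] {A B : H →L[ℂ] H}
    (hA : A.IsPositive) (hB : B.IsPositive) :
    divergence A B ≤ liminf (fun F : Finset (refIndex H) =>
      divergence (compress F A) (compress F B)) atTop := by
  have hm : ∀ F : Finset (refIndex H), AEMeasurable (fun t : ℝ =>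
      resolventSup t (compress F A) (compress F B) * ENNReal.ofReal ((1 + t) ^ 2)⁻¹)
        (volume.restrict (Ioi 0)) := fun F =>
    (aemeasurable_resolventSup (isPositive_compress hA F) (isPositive_compress hB F)).mul
      (by fun_prop)
  -- Fatou's lemma along finite subsets, a countable directed set since the basis is countable.
  refine le_trans ?_ (lintegral_liminf_le' hm)
  refine lintegral_mono fun t => ?_
  simp_rw [mul_comm _ (ENNReal.ofReal _)]
  rw [ENNReal.liminf_const_mul_of_ne_top ENNReal.ofReal_ne_top]
  gcongr
  exact resolventSup_le_liminf_compress t A B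

theorem sum_mul_divergence_le_liminf_compress [Countable (refIndex H)] {ι : Type*} [Fintype ι]
    (p : ι → ℝ) {ρ : ι → H →L[ℂ] H} {τ : H →L[ℂ] H} (hρ : ∀ i, (ρ i).IsPositive)
    (hτ : τ.IsPositive) :
    ∑ i, ENNReal.ofReal (p i) * divergence (ρ i) τ ≤ liminf (fun F : Finset (refIndex H) =>
      ∑ i, ENNReal.ofReal (p i) * divergence (compress F (ρ i)) (compress F τ)) atTop := by
  -- Fatou for the counting measure: a finite sum of lower limits is at most the lower limit of the
  -- sums.
  let _ : MeasurableSpace ι := ⊤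
  simp_rw [← tsum_fintype (L := SummationFilter.unconditional ι), ← lintegral_count]
  refine le_trans (lintegral_mono fun i => ?_) (lintegral_liminf_le fun F => measurable_from_top)
  rw [ENNReal.liminf_const_mul_of_ne_top ENNReal.ofReal_ne_top]
  gcongr
  exact divergence_le_liminf_compress (hρ i) hτ

end Compression

/-! ### Traces in infinite dimensions -/

section Trace

variable {H : Type u} [NormedAddCommGroup H] [InnerProductSpace ℂ H]

/-- Orthonormal vectors are at distance √2, so balls of radius 1/2 around them are disjoint. -/
theorem countable_of_orthonormal [TopologicalSpace.SeparableSpace H] {I : Type*} {e : I → H}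
    (he : Orthonormal ℂ e) : Countable I := by
  refine Pairwise.countable_of_isOpen_disjoint (s := fun i => Metric.ball (e i) (1 / 2)) ?_
    (fun i => Metric.isOpen_ball) fun i => ⟨e i, Metric.mem_ball_self (by norm_num)⟩
  intro i j hij
  refine Metric.ball_disjoint_ball ?_
  have h1 : ‖e i - e j‖ ^ 2 = 2 := by
    rw [norm_sub_sq (𝕜 := ℂ), he.2 hij, he.1, he.1]
    norm_num
  rw [dist_eq_norm]
  nlinarith [norm_nonneg (e i - e j)]

theorem ofReal_norm_sq_eq_tsum {I : Type*} (e : HilbertBasis I ℂ H) (x : H) :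
    ENNReal.ofReal (‖x‖ ^ 2) = ∑' i, ENNReal.ofReal (‖⟪e i, x⟫_ℂ‖ ^ 2) := by
  have h1 := Complex.hasSum_re (e.hasSum_inner_mul_inner x x)
  have h2 : (fun i => (⟪x, e i⟫_ℂ * ⟪e i, x⟫_ℂ).re) = fun i => ‖⟪e i, x⟫_ℂ‖ ^ 2 := by
    funext i
    rw [← inner_conj_symm x (e i), ← Complex.normSq_eq_conj_mul_self, Complex.ofReal_re,
      Complex.normSq_eq_norm_sq]
  have h3 : (⟪x, x⟫_ℂ).re = ‖x‖ ^ 2 := inner_self_eq_norm_sq (𝕜 := ℂ) x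
  rw [h2, h3] at h1
  rw [← h1.tsum_eq, ENNReal.ofReal_tsum_of_nonneg (fun i => by positivity) h1.summable]

variable [CompleteSpace H]

theorem countable_refIndex [TopologicalSpace.SeparableSpace H] : Countable (refIndex H) :=
  countable_of_orthonormal (refBasis H).orthonormal

theorem exists_symmetric_sqrt {A : H →L[ℂ] H} (hA : A.IsPositive) :
    ∃ S : H →L[ℂ] H, S.IsSymmetric ∧ ∀ x, (⟪x, A x⟫_ℂ).re = ‖S x‖ ^ 2 := by
  have h0 : (0 : H →L[ℂ] H) ≤ A := (ContinuousLinearMap.nonneg_iff_isPositive _).2 hA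
  have hS : (CFC.sqrt A).IsPositive :=
    (ContinuousLinearMap.nonneg_iff_isPositive _).1 (CFC.sqrt_nonneg _)
  have hSS : CFC.sqrt A ∘L CFC.sqrt A = A := CFC.sqrt_mul_sqrt_self _ h0
  refine ⟨CFC.sqrt A, hS.isSymmetric, fun x => ?_⟩
  have h1 : ⟪x, A x⟫_ℂ = ⟪CFC.sqrt A x, CFC.sqrt A x⟫_ℂ := by
    conv_lhs => rw [← hSS]
    exact (hS.isSymmetric x _).symm
  rw [h1]
  exact inner_self_eq_norm_sq (𝕜 := ℂ) _

/-- With S a symmetric square root of A, both sides expand by Parseval into the double sum of |⟨e_i,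
S f_j⟩|², and Tonelli exchanges the order. -/
theorem posTrace_eq_tsum {I : Type*} (e : HilbertBasis I ℂ H) {A : H →L[ℂ] H}
    (hA : A.IsPositive) : posTrace A = ∑' i, ENNReal.ofReal (⟪e i, A (e i)⟫_ℂ).re := by
  obtain ⟨S, hS, hSA⟩ := exists_symmetric_sqrt hA
  unfold posTrace
  simp_rw [hSA]
  rw [tsum_congr fun i => ofReal_norm_sq_eq_tsum e (S (refBasis H i)), ENNReal.tsum_comm]
  refine tsum_congr fun i => ?_
  rw [ofReal_norm_sq_eq_tsum (refBasis H)]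
  refine tsum_congr fun j => ?_
  rw [norm_inner_symm]
  congr 3
  exact hS _ _

theorem ofReal_re_inner_le_posTrace {A : H →L[ℂ] H} (hA : A.IsPositive) (x : H) :
    ENNReal.ofReal (⟪x, A x⟫_ℂ).re ≤ posTrace A * ENNReal.ofReal (‖x‖ ^ 2) := by
  obtain ⟨S, hS, hSA⟩ := exists_symmetric_sqrt hA
  unfold posTrace
  simp_rw [hSA]
  rw [ofReal_norm_sq_eq_tsum (refBasis H), ← ENNReal.tsum_mul_right]
  refine ENNReal.tsum_le_tsum fun i => ?_
  rw [← ENNReal.ofReal_mul (by positivity), ← mul_pow]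
  gcongr
  have h : ⟪refBasis H i, S x⟫_ℂ = ⟪S (refBasis H i), x⟫_ℂ := (hS _ _).symm
  rw [h]
  exact norm_inner_le_norm _ _

theorem posTrace_add {A B : H →L[ℂ] H} (hA : A.IsPositive) (hB : B.IsPositive) :
    posTrace (A + B) = posTrace A + posTrace B := by
  unfold posTrace
  rw [← ENNReal.tsum_add]
  refine tsum_congr fun i => ?_
  rw [_root_.add_apply, inner_add_right, Complex.add_re]
  exact ENNReal.ofReal_add (hA.re_inner_nonneg_right _) (hB.re_inner_nonneg_right _)

theorem hasSum_toReal_posTrace {I : Type*} (e : HilbertBasis I ℂ H) {A : H →L[ℂ] H}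
    (hA : A.IsPositive) (h : posTrace A ≠ ⊤) :
    HasSum (fun i => (⟪e i, A (e i)⟫_ℂ).re) (posTrace A).toReal := by
  rw [posTrace_eq_tsum e hA] at h ⊢
  have h1 := ENNReal.hasSum_toReal h
  rw [← ENNReal.tsum_toReal_eq fun i => ENNReal.ofReal_ne_top] at h1
  refine h1.congr_fun fun i => ?_
  exact (ENNReal.toReal_ofReal (hA.re_inner_nonneg_right _)).symm

theorem tendsto_reTrace_compress {A : H →L[ℂ] H} (hA : A.IsPositive) (h : posTrace A ≠ ⊤) :
    Tendsto (fun F : Finset (refIndex H) => reTrace (compress F A)) atTop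
      (𝓝 (posTrace A).toReal) := by
  simp_rw [reTrace_compress]
  exact hasSum_toReal_posTrace (refBasis H) hA h

theorem posTrace_eq_ofReal_reTrace [FiniteDimensional ℂ H] {A : H →L[ℂ] H} (hA : A.IsPositive) :
    posTrace A = ENNReal.ofReal (reTrace A) := by
  have h : posTrace A = ∑' i, ENNReal.ofReal
      (⟪stdOrthonormalBasis ℂ H i, A (stdOrthonormalBasis ℂ H i)⟫_ℂ).re := by
    simpa using posTrace_eq_tsum (stdOrthonormalBasis ℂ H).toHilbertBasis hA
  rw [h, tsum_fintype, reTrace_eq_sum (stdOrthonormalBasis ℂ H), ENNReal.ofReal_sum_of_nonneg]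
  exact fun i _ => hA.re_inner_nonneg_right _

/-- The spectral theorem is needed for differences of states, which are compact and self-adjoint but
not states. Orthonormal bases of the eigenspaces are glued together. -/
theorem exists_eigenBasis_of_isCompactOperator {T : H →L[ℂ] H} (hc : IsCompactOperator T)
    (hT : T.IsSymmetric) : Nonempty (EigenBasis T) := by
  have hsym : (T : H →ₗ[ℂ] H).IsSymmetric := hT
  have horth := hsym.orthogonalFamily_eigenspaces
  have hbot := ContinuousLinearMap.orthogonalComplement_iSup_eigenspaces_eq_bot hc hT
  have hcl : ∀ μ : ℂ, CompleteSpace (Module.End.eigenspace (T : Module.End ℂ H) μ) := by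
    intro μ
    have : IsClosed ((Module.End.eigenspace (T : Module.End ℂ H) μ : Set H)) := by
      have : (Module.End.eigenspace (T : Module.End ℂ H) μ : Set H) = {x | T x = μ • x} := by
        ext x; simp
      rw [this]
      exact isClosed_eq T.continuous (continuous_const_smul μ)
    exact this.completeSpace_coe
  choose w b hb using fun μ : ℂ =>
    exists_hilbertBasis ℂ (Module.End.eigenspace (T : Module.End ℂ H) μ)
  have hon := horth.orthonormal_sigma_orthonormal (fun μ => (b μ).orthonormal)
  have hsp : (Submodule.span ℂ (Set.range fun a : Σ μ, w μ => ((b a.1 a.2 : _) : H)))ᗮ = ⊥ := by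
    rw [eq_bot_iff, ← hbot]
    intro x hx
    rw [Submodule.mem_orthogonal] at hx
    rw [← Submodule.iInf_orthogonal, Submodule.mem_iInf]
    intro μ
    rw [Submodule.mem_orthogonal]
    intro y hy
    have h1 := ((b μ).hasSum_repr ⟨y, hy⟩).mapL
      ((Module.End.eigenspace (T : Module.End ℂ H) μ).subtypeL)
    have h2 := h1.mapL (innerSL ℂ x)
    have h3 : (fun i => innerSL ℂ x ((Module.End.eigenspace (T : Module.End ℂ H) μ).subtypeL
        ((b μ).repr ⟨y, hy⟩ i • b μ i))) = fun _ => (0 : ℂ) := by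
      funext i
      have h4 : ⟪x, (b μ i : H)⟫_ℂ = 0 := by
        rw [← inner_conj_symm, hx _ (Submodule.subset_span ⟨⟨μ, i⟩, rfl⟩), map_zero]
      simp [h4]
    rw [h3] at h2
    have h5 : ⟪x, y⟫_ℂ = 0 := h2.unique hasSum_zero
    rw [← inner_conj_symm, h5, map_zero]
  let B := HilbertBasis.mkOfOrthogonalEqBot hon hsp
  have hB : ∀ a : Σ μ, w μ, B a = ((b a.1 a.2 : _) : H) := fun a =>
    congrFun (HilbertBasis.coe_mkOfOrthogonalEqBot hon hsp) a
  refine ⟨⟨_, B, fun a => a.1.re, fun a => ?_⟩⟩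
  have hmem : B a ∈ Module.End.eigenspace (T : Module.End ℂ H) a.1 := by
    rw [hB]; exact (b a.1 a.2).2
  have hne : B a ≠ 0 := B.orthonormal.ne_zero a
  have hreal : (a.1.re : ℂ) = a.1 := Complex.conj_eq_iff_re.1
    (hsym.conj_eigenvalue_eq_self (Module.End.hasEigenvalue_of_hasEigenvector ⟨hmem, hne⟩))
  rw [hreal]
  exact Module.End.mem_eigenspace_iff.1 hmem

/-- The positive and negative parts of a self-adjoint operator. -/
theorem exists_jordan_decomposition {T : H →L[ℂ] H} (hT : IsSelfAdjoint T) :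
    ∃ P N : H →L[ℂ] H, P.IsPositive ∧ N.IsPositive ∧ T = P - N ∧ CFC.abs T = P + N ∧
      P * N = 0 ∧ N * P = 0 := by
  refine ⟨T⁺, T⁻, ?_, ?_, (CFC.posPart_sub_negPart T hT).symm,
    (CFC.posPart_add_negPart T hT).symm, CFC.posPart_mul_negPart T, CFC.negPart_mul_posPart T⟩
  · exact (ContinuousLinearMap.nonneg_iff_isPositive _).1 (CFC.posPart_nonneg T)
  · exact (ContinuousLinearMap.nonneg_iff_isPositive _).1 (CFC.negPart_nonneg T)

/-- P x and N x are eigenvectors, if nonzero, of P for c and of N for −c. Positivity lets at most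
one survive when c ≠ 0, so |T| acts on x as ±T. -/
theorem inner_abs_eigenvector {T : H →L[ℂ] H} (hT : IsSelfAdjoint T) {x : H} {c : ℝ}
    (hx : T x = (c : ℂ) • x) : (⟪x, CFC.abs T x⟫_ℂ).re ≤ |(⟪x, T x⟫_ℂ).re| := by
  obtain ⟨P, N, hP, hN, hPN, habs, h1, h2⟩ := exists_jordan_decomposition hT
  have e1 : P (N x) = 0 := congrArg (fun A : H →L[ℂ] H => A x) h1
  have e2 : N (P x) = 0 := congrArg (fun A : H →L[ℂ] H => A x) h2
  have e3 : P x - N x = (c : ℂ) • x := by rw [← hx, hPN]; rfl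
  have hinner : ⟪P x, N x⟫_ℂ = 0 := by
    have := hP.isSymmetric x (N x)
    simp only [ContinuousLinearMap.coe_coe] at this
    rw [this, e1, inner_zero_right]
  rcases eq_or_ne c 0 with rfl | hc
  -- For c = 0 the orthogonal vectors P x and N x are equal, hence zero.
  · have e4 : P x = N x := by simpa [sub_eq_zero] using e3
    have e5 : P x = 0 := by
      rw [← e4] at hinner
      exact inner_self_eq_zero.1 hinner
    rw [habs, _root_.add_apply, ← e4, e5]
    simp
  · have e4 : ⟪x, P x⟫_ℂ = 0 ∨ ⟪x, N x⟫_ℂ = 0 := by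
      by_cases hPx : P x = 0
      · left; rw [hPx, inner_zero_right]
      · right
        have e5 : P (P x) = (c : ℂ) • P x := by
          rw [← map_smul, ← e3, map_sub, e1, sub_zero]
        have e6 : N (N x) = (-c : ℂ) • N x := by
          have h := congrArg N e3
          rw [map_sub, e2, map_smul, zero_sub] at h
          rw [neg_smul, ← h, neg_neg]
        have hcpos : 0 < c := by
          have h := hP.re_inner_nonneg_right (P x)
          rw [e5, inner_smul_right, inner_self_eq_norm_sq_to_K] at h
          have h' : 0 ≤ c * ‖P x‖ ^ 2 := by
            have : ((c : ℂ) * (‖P x‖ : ℂ) ^ 2) = ((c * ‖P x‖ ^ 2 : ℝ) : ℂ) := by push_cast; rfl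
            erw [this] at h
            exact h
          have h'' : 0 < ‖P x‖ ^ 2 := by positivity
          exact lt_of_le_of_ne (nonneg_of_mul_nonneg_left h' h'') hc.symm
        have hNx : N x = 0 := by
          have h := hN.re_inner_nonneg_right (N x)
          rw [e6, inner_smul_right, inner_self_eq_norm_sq_to_K] at h
          have h' : 0 ≤ -c * ‖N x‖ ^ 2 := by
            have : ((-c : ℂ) * (‖N x‖ : ℂ) ^ 2) = ((-c * ‖N x‖ ^ 2 : ℝ) : ℂ) := by push_cast; rfl
            erw [this] at h
            exact h
          have h3 : ‖N x‖ ^ 2 = 0 := by nlinarith [sq_nonneg ‖N x‖]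
          simpa using h3
        rw [hNx, inner_zero_right]
    rw [habs, hPN, _root_.add_apply, _root_.sub_apply, inner_add_right, inner_sub_right,
      Complex.add_re, Complex.sub_re]
    have p1 : 0 ≤ (⟪x, P x⟫_ℂ).re := hP.re_inner_nonneg_right x
    have p2 : 0 ≤ (⟪x, N x⟫_ℂ).re := hN.re_inner_nonneg_right x
    rcases e4 with e4 | e4
    · simp [e4, abs_of_nonneg p2]
    · simp [e4, abs_of_nonneg p1]

theorem State.isSelfAdjoint_sub (ρ σ : State H) : IsSelfAdjoint (ρ.op - σ.op) :=
  ρ.pos.isSelfAdjoint.sub σ.pos.isSelfAdjoint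

/-- In an eigenbasis of ρ − σ the diagonal entries of |ρ − σ| are at most |⟨ρ⟩ − ⟨σ⟩| ≤ ⟨ρ⟩ + ⟨σ⟩.
-/
theorem traceNorm_sub_le_two (ρ σ : State H) : traceNorm (ρ.op - σ.op) ≤ 2 := by
  obtain ⟨e⟩ := exists_eigenBasis_of_isCompactOperator
    (ρ.isCompactOperator.sub σ.isCompactOperator) (ρ.isSelfAdjoint_sub σ).isSymmetric
  have habs : (CFC.abs (ρ.op - σ.op)).IsPositive :=
    (ContinuousLinearMap.nonneg_iff_isPositive _).1 (CFC.abs_nonneg _)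
  rw [traceNorm, posTrace_eq_tsum e.basis habs]
  calc ∑' i, ENNReal.ofReal (⟪e.basis i, CFC.abs (ρ.op - σ.op) (e.basis i)⟫_ℂ).re
      ≤ ∑' i, (ENNReal.ofReal (⟪e.basis i, ρ.op (e.basis i)⟫_ℂ).re +
          ENNReal.ofReal (⟪e.basis i, σ.op (e.basis i)⟫_ℂ).re) := by
        refine ENNReal.tsum_le_tsum fun i => ?_
        have p1 : 0 ≤ (⟪e.basis i, ρ.op (e.basis i)⟫_ℂ).re := ρ.pos.re_inner_nonneg_right _
        have p2 : 0 ≤ (⟪e.basis i, σ.op (e.basis i)⟫_ℂ).re := σ.pos.re_inner_nonneg_right _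
        rw [← ENNReal.ofReal_add p1 p2]
        refine ENNReal.ofReal_le_ofReal
          ((inner_abs_eigenvector (ρ.isSelfAdjoint_sub σ) (e.apply_basis i)).trans ?_)
        rw [_root_.sub_apply, inner_sub_right, Complex.sub_re]
        exact (abs_sub _ _).trans_eq (by rw [abs_of_nonneg p1, abs_of_nonneg p2])
    _ = 2 := by
        rw [ENNReal.tsum_add, ← posTrace_eq_tsum e.basis ρ.pos, ← posTrace_eq_tsum e.basis σ.pos,
          ρ.trace_eq_one, σ.trace_eq_one, one_add_one_eq_two]

/-- Both states have trace one, so the two Jordan parts have equal trace, each half of the trace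
norm. The relation is kept as an equality of sums of positive operators, the form superadditivity
acts on. -/
theorem exists_add_eq_add_of_states (ρ σ : State H) : ∃ P N : H →L[ℂ] H, P.IsPositive ∧
    N.IsPositive ∧ ρ.op + N = σ.op + P ∧
    posTrace P = ENNReal.ofReal ((traceNorm (ρ.op - σ.op)).toReal / 2) ∧
    posTrace N = ENNReal.ofReal ((traceNorm (ρ.op - σ.op)).toReal / 2) := by
  obtain ⟨P, N, hP, hN, hPN, habs, -, -⟩ := exists_jordan_decomposition (ρ.isSelfAdjoint_sub σ)
  have h1 : ρ.op + N = σ.op + P := by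
    rw [← sub_eq_zero, add_sub_add_comm, hPN]
    abel
  have h2 : posTrace N = posTrace P := by
    have h := congrArg posTrace h1
    rw [posTrace_add ρ.pos hN, posTrace_add σ.pos hP, ρ.trace_eq_one, σ.trace_eq_one] at h
    exact (ENNReal.add_right_inj ENNReal.one_ne_top).1 h
  have h3 : traceNorm (ρ.op - σ.op) = 2 * posTrace P := by
    rw [traceNorm, habs, posTrace_add hP hN, h2, two_mul]
  have hfin : posTrace P ≠ ⊤ := fun h => by
    have := traceNorm_sub_le_two ρ σ
    rw [h3, h, ENNReal.mul_top (by norm_num)] at this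
    exact absurd this (by simp)
  have h4 : ENNReal.ofReal ((traceNorm (ρ.op - σ.op)).toReal / 2) = posTrace P := by
    rw [h3, ENNReal.toReal_mul, ENNReal.toReal_ofNat, mul_div_cancel_left₀ _ two_ne_zero,
      ENNReal.ofReal_toReal hfin]
  exact ⟨P, N, hP, hN, h1, h4.symm, h2.trans h4.symm⟩

theorem abs_re_inner_le_traceNorm (ρ σ : State H) (x : H) :
    |(⟪x, (ρ.op - σ.op) x⟫_ℂ).re| ≤ (traceNorm (ρ.op - σ.op)).toReal * ‖x‖ ^ 2 := by
  obtain ⟨P, N, hP, hN, hPN, habs, -, -⟩ := exists_jordan_decomposition (ρ.isSelfAdjoint_sub σ)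
  have hpos : (CFC.abs (ρ.op - σ.op)).IsPositive :=
    (ContinuousLinearMap.nonneg_iff_isPositive _).1 (CFC.abs_nonneg _)
  have h1 : (⟪x, CFC.abs (ρ.op - σ.op) x⟫_ℂ).re ≤ (traceNorm (ρ.op - σ.op)).toReal * ‖x‖ ^ 2 := by
    have hfin : traceNorm (ρ.op - σ.op) ≠ ⊤ :=
      ((traceNorm_sub_le_two ρ σ).trans_lt ENNReal.ofNat_lt_top).ne
    have h := ofReal_re_inner_le_posTrace hpos x
    have h' := ENNReal.toReal_mono (ENNReal.mul_ne_top hfin ENNReal.ofReal_ne_top) h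
    have hx : 0 ≤ (⟪x, CFC.abs (ρ.op - σ.op) x⟫_ℂ).re := hpos.re_inner_nonneg_right x
    rwa [ENNReal.toReal_mul, ENNReal.toReal_ofReal hx,
      ENNReal.toReal_ofReal (sq_nonneg ‖x‖)] at h'
  refine le_trans ?_ h1
  rw [habs, hPN, _root_.add_apply, _root_.sub_apply, inner_add_right, inner_sub_right,
    Complex.add_re, Complex.sub_re]
  have p1 : 0 ≤ (⟪x, P x⟫_ℂ).re := hP.re_inner_nonneg_right x
  have p2 : 0 ≤ (⟪x, N x⟫_ℂ).re := hN.re_inner_nonneg_right x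
  exact (abs_sub _ _).trans_eq (by rw [abs_of_nonneg p1, abs_of_nonneg p2])

end Trace

/-! ### Relative entropy and Holevo quantity in terms of spectral sums -/

section Entropy

variable {H : Type u} [NormedAddCommGroup H] [InnerProductSpace ℂ H]

theorem EigenBasis.re_inner {T : H →L[ℂ] H} (e : EigenBasis T) (i : e.idx) :
    (⟪e.basis i, T (e.basis i)⟫_ℂ).re = e.eigenvalue i := by
  rw [e.apply_basis, inner_smul_right, inner_self_eq_norm_sq_to_K, e.basis.orthonormal.1]
  simp

variable [CompleteSpace H]

theorem State.eigenvalue_nonneg (ρ : State H) (i : ρ.eigenBasis.idx) :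
    0 ≤ ρ.eigenBasis.eigenvalue i := by
  rw [← EigenBasis.re_inner]
  exact ρ.pos.re_inner_nonneg_right _

theorem State.hasSum_re_inner (ρ : State H) {I : Type*} (e : HilbertBasis I ℂ H) :
    HasSum (fun i => (⟪e i, ρ.op (e i)⟫_ℂ).re) 1 := by
  have h := hasSum_toReal_posTrace e ρ.pos (by rw [ρ.trace_eq_one]; simp)
  rwa [ρ.trace_eq_one, ENNReal.toReal_one] at h

theorem State.hasSum_eigenvalue (ρ : State H) : HasSum ρ.eigenBasis.eigenvalue 1 :=
  (ρ.hasSum_re_inner ρ.eigenBasis.basis).congr_fun fun i => (ρ.eigenBasis.re_inner i).symm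

theorem State.eigenvalue_le_one (ρ : State H) (i : ρ.eigenBasis.idx) :
    ρ.eigenBasis.eigenvalue i ≤ 1 :=
  le_hasSum ρ.hasSum_eigenvalue i fun j _ => ρ.eigenvalue_nonneg j

theorem State.ker_le_of_supp_le {ρ σ : State H} (h : ρ.supp ≤ σ.supp) (x : H)
    (hx : σ.op x = 0) : ρ.op x = 0 := by
  have h1 : LinearMap.ker σ.op.toLinearMap ≤ LinearMap.ker ρ.op.toLinearMap := by
    have h2 := Submodule.orthogonal_le h
    unfold State.supp at h2
    rwa [Submodule.orthogonal_orthogonal_eq_closure, Submodule.orthogonal_orthogonal_eq_closure,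
      IsClosed.submodule_topologicalClosure_eq (ContinuousLinearMap.isClosed_ker σ.op),
      IsClosed.submodule_topologicalClosure_eq (ContinuousLinearMap.isClosed_ker ρ.op)] at h2
  exact h1 hx

/-- The relative entropy of states as a sum of nonnegative terms over pairs of eigenvectors. -/
def spectralRelEntropy (ρ σ : State H) : ℝ≥0∞ :=
  overlapSum ρ.eigenBasis.basis σ.eigenBasis.basis ρ.eigenBasis.eigenvalue
    σ.eigenBasis.eigenvalue scalarRelEnt

theorem State.inner_eigenBasis_eq_zero {ρ σ : State H} (h : ∀ x, σ.op x = 0 → ρ.op x = 0)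
    (i : ρ.eigenBasis.idx) (j : σ.eigenBasis.idx) (hj : σ.eigenBasis.eigenvalue j = 0)
    (hi : ρ.eigenBasis.eigenvalue i ≠ 0) :
    ⟪σ.eigenBasis.basis j, ρ.eigenBasis.basis i⟫_ℂ = 0 :=
  inner_eq_zero_of_ker_le (u := ρ.eigenBasis.basis) (v := σ.eigenBasis.basis) ρ.pos.isSymmetric
    ρ.eigenBasis.apply_basis σ.eigenBasis.apply_basis h i j hj hi

theorem spectralRelEntropy_le_divergence [TopologicalSpace.SeparableSpace H] {ρ σ : State H}
    (h : ∀ x, σ.op x = 0 → ρ.op x = 0) : spectralRelEntropy ρ σ ≤ divergence ρ.op σ.op := by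
  have := countable_of_orthonormal ρ.eigenBasis.basis.orthonormal
  have := countable_of_orthonormal σ.eigenBasis.basis.orthonormal
  exact overlapSum_le_divergence ρ.eigenBasis.basis.orthonormal σ.eigenBasis.basis.orthonormal
    ρ.pos.isSymmetric ρ.eigenBasis.apply_basis σ.eigenBasis.apply_basis ρ.eigenvalue_nonneg
    σ.eigenvalue_nonneg (State.inner_eigenBasis_eq_zero h)

theorem spectralRelEntropy_self (ρ : State H) : spectralRelEntropy ρ ρ = 0 := by
  unfold spectralRelEntropy overlapSum
  rw [ENNReal.tsum_eq_zero]
  rintro ⟨i, j⟩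
  rcases eq_or_ne i j with rfl | hij
  · simp [scalarRelEnt]
  · simp [ρ.eigenBasis.basis.orthonormal.2 hij.symm]

/-- This is −a log b + b = `scalarRelEnt a b` + (a − a log a), summed against the overlaps. Since
eigenvalues lie in [0, 1], the terms are arranged to be nonnegative, so the identity makes sense in
[0, ∞] even when infinite. -/
theorem mul_negLogForm_add (ρ σ : State H) (h : ∀ x, σ.op x = 0 → ρ.op x = 0)
    (i : ρ.eigenBasis.idx) :
    ENNReal.ofReal (ρ.eigenBasis.eigenvalue i) * negLogForm σ (ρ.eigenBasis.basis i) +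
      ENNReal.ofReal (⟪ρ.eigenBasis.basis i, σ.op (ρ.eigenBasis.basis i)⟫_ℂ).re =
    (∑' j, ENNReal.ofReal (‖⟪σ.eigenBasis.basis j, ρ.eigenBasis.basis i⟫_ℂ‖ ^ 2 *
      scalarRelEnt (ρ.eigenBasis.eigenvalue i) (σ.eigenBasis.eigenvalue j))) +
    ENNReal.ofReal (ρ.eigenBasis.eigenvalue i -
      ρ.eigenBasis.eigenvalue i * Real.log (ρ.eigenBasis.eigenvalue i)) := by
  set a := ρ.eigenBasis.eigenvalue i with ha
  set x := ρ.eigenBasis.basis i with hx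
  have ha0 : 0 ≤ a := ρ.eigenvalue_nonneg i
  have hlog : 0 ≤ a - a * Real.log a := by
    have := mul_nonpos_of_nonneg_of_nonpos ha0 (Real.log_nonpos ha0 (ρ.eigenvalue_le_one i))
    linarith
  have h1 : ENNReal.ofReal (⟪x, σ.op x⟫_ℂ).re = ∑' j,
      ENNReal.ofReal (‖⟪σ.eigenBasis.basis j, x⟫_ℂ‖ ^ 2 * σ.eigenBasis.eigenvalue j) := by
    have hs := Complex.hasSum_re (σ.eigenBasis.basis.hasSum_inner_mul_inner x (σ.op x))
    have he : (fun j => (⟪x, σ.eigenBasis.basis j⟫_ℂ * ⟪σ.eigenBasis.basis j, σ.op x⟫_ℂ).re) =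
        fun j => ‖⟪σ.eigenBasis.basis j, x⟫_ℂ‖ ^ 2 * σ.eigenBasis.eigenvalue j := by
      funext j
      have := σ.pos.isSymmetric (σ.eigenBasis.basis j) x
      simp only [ContinuousLinearMap.coe_coe] at this
      rw [← this, σ.eigenBasis.apply_basis, inner_smul_left, Complex.conj_ofReal, mul_left_comm,
        Complex.re_ofReal_mul, ← inner_conj_symm x, ← Complex.normSq_eq_conj_mul_self,
        Complex.ofReal_re, Complex.normSq_eq_norm_sq, mul_comm]
    rw [he] at hs
    rw [← hs.tsum_eq, ENNReal.ofReal_tsum_of_nonneg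
      (fun j => mul_nonneg (sq_nonneg _) (σ.eigenvalue_nonneg j)) hs.summable]
  have h2 : ENNReal.ofReal (a - a * Real.log a) = ∑' j,
      ENNReal.ofReal (‖⟪σ.eigenBasis.basis j, x⟫_ℂ‖ ^ 2 * (a - a * Real.log a)) := by
    simp_rw [ENNReal.ofReal_mul (sq_nonneg _)]
    rw [ENNReal.tsum_mul_right, ← ofReal_norm_sq_eq_tsum, hx, ρ.eigenBasis.basis.orthonormal.1]
    simp
  rw [h1, h2, negLogForm, ← ENNReal.tsum_mul_left, ← ENNReal.tsum_add, ← ENNReal.tsum_add]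
  refine tsum_congr fun j => ?_
  set b := σ.eigenBasis.eigenvalue j with hb
  have hb0 : 0 ≤ b := σ.eigenvalue_nonneg j
  have hblog : 0 ≤ -Real.log b := neg_nonneg.2 (Real.log_nonpos hb0 (σ.eigenvalue_le_one j))
  by_cases hab : b = 0 → a = 0
  · rw [← ENNReal.ofReal_mul (by positivity), ← ENNReal.ofReal_mul ha0,
      ← ENNReal.ofReal_add (by positivity) (by positivity),
      ← ENNReal.ofReal_add (mul_nonneg (sq_nonneg _) (scalarRelEnt_nonneg ha0 hb0 hab))
        (by positivity)]
    congr 1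
    unfold scalarRelEnt
    ring
  · push Not at hab
    simp [hx, State.inner_eigenBasis_eq_zero h i j hab.1 hab.2]

theorem ereal_coe_ennreal_sum {I : Type*} (F : Finset I) (f : I → ℝ≥0∞) :
    ((∑ i ∈ F, f i : ℝ≥0∞) : EReal) = ∑ i ∈ F, (f i : EReal) := by
  classical
  induction F using Finset.induction_on with
  | empty => simp
  | insert i F hi ih => rw [Finset.sum_insert hi, Finset.sum_insert hi, EReal.coe_ennreal_add, ih]

theorem ereal_coe_real_sum {I : Type*} (F : Finset I) (f : I → ℝ) :
    ((∑ i ∈ F, f i : ℝ) : EReal) = ∑ i ∈ F, (f i : EReal) := by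
  classical
  induction F using Finset.induction_on with
  | empty => simp
  | insert i F hi ih => rw [Finset.sum_insert hi, Finset.sum_insert hi, EReal.coe_add, ih]

theorem ereal_coe_add_eq {x y : ℝ≥0∞} {s m : ℝ} (hs : 0 ≤ s) {a : ℝ} (hm : 0 ≤ a - m)
    (h : x + ENNReal.ofReal s = y + ENNReal.ofReal (a - m)) :
    ((m : ℝ) : EReal) + (x : EReal) = (y : EReal) + ((a - s : ℝ) : EReal) := by
  induction x with
  | top =>
    have hy : y = ⊤ := by
      rw [top_add] at h
      by_contra hy
      exact ENNReal.add_ne_top.2 ⟨hy, ENNReal.ofReal_ne_top⟩ h.symm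
    subst hy
    rw [EReal.coe_ennreal_top, EReal.coe_add_top, EReal.top_add_coe]
  | coe x =>
    induction y with
    | top => simp at h
    | coe y =>
      have h1 := congrArg ENNReal.toReal h
      rw [ENNReal.toReal_add (by simp) (by simp), ENNReal.toReal_add (by simp) (by simp),
        ENNReal.toReal_ofReal hs, ENNReal.toReal_ofReal hm] at h1
      simp only [ENNReal.coe_toReal] at h1
      rw [EReal.coe_nnreal_eq_coe_real, EReal.coe_nnreal_eq_coe_real, ← EReal.coe_add,
        ← EReal.coe_add]
      congr 1
      linarith

theorem relEntropy_le_spectralRelEntropy {ρ σ : State H} (h : ρ.supp ≤ σ.supp) :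
    relEntropy ρ σ ≤ (spectralRelEntropy ρ σ : EReal) := by
  have hk := State.ker_le_of_supp_le h
  rw [relEntropy, if_pos h]
  set f : ρ.eigenBasis.idx → EReal := fun i =>
    (((ρ.eigenBasis.eigenvalue i * Real.log (ρ.eigenBasis.eigenvalue i) : ℝ) : EReal) +
      ((ENNReal.ofReal (ρ.eigenBasis.eigenvalue i) * negLogForm σ (ρ.eigenBasis.basis i) : ℝ≥0∞) :
        EReal)) with hf
  by_cases hsum : Summable f
  swap
  -- A non-summable family has sum 0 by default, so the upper bound needs no proof of convergence.
  · rw [tsum_eq_zero_of_not_summable hsum]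
    exact EReal.coe_ennreal_nonneg _
  rcases eq_or_ne (spectralRelEntropy ρ σ) ⊤ with htop | htop
  · rw [htop]
    exact le_top
  set G : ρ.eigenBasis.idx → ℝ≥0∞ := fun i =>
    ∑' j, ENNReal.ofReal (‖⟪σ.eigenBasis.basis j, ρ.eigenBasis.basis i⟫_ℂ‖ ^ 2 *
      scalarRelEnt (ρ.eigenBasis.eigenvalue i) (σ.eigenBasis.eigenvalue j)) with hG
  have hGsum : ∑' i, G i = spectralRelEntropy ρ σ := by
    rw [spectralRelEntropy, overlapSum, ENNReal.tsum_prod']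
  -- The correction between the defining terms and the nonnegative ones; it sums to 1 − 1 = 0
  -- because both states have unit trace.
  set r : ρ.eigenBasis.idx → ℝ := fun i => ρ.eigenBasis.eigenvalue i -
    (⟪ρ.eigenBasis.basis i, σ.op (ρ.eigenBasis.basis i)⟫_ℂ).re with hr
  have hrsum : HasSum r 0 := by
    have := ρ.hasSum_eigenvalue.sub (σ.hasSum_re_inner ρ.eigenBasis.basis)
    rwa [sub_self] at this
  have hfG : ∀ i, f i = (G i : EReal) + (r i : EReal) := fun i => by
    refine ereal_coe_add_eq (σ.pos.re_inner_nonneg_right _) ?_ (mul_negLogForm_add ρ σ hk i)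
    have := mul_nonpos_of_nonneg_of_nonpos (ρ.eigenvalue_nonneg i)
      (Real.log_nonpos (ρ.eigenvalue_nonneg i) (ρ.eigenvalue_le_one i))
    have := ρ.eigenvalue_nonneg i
    linarith
  have hlim : Tendsto (fun F : Finset ρ.eigenBasis.idx =>
      (((spectralRelEntropy ρ σ).toReal + ∑ i ∈ F, r i : ℝ) : EReal)) atTop
        (𝓝 (((spectralRelEntropy ρ σ).toReal + 0 : ℝ) : EReal)) :=
    (continuous_coe_real_ereal.tendsto _).comp (tendsto_const_nhds.add hrsum)
  rw [add_zero, EReal.coe_ennreal_toReal htop] at hlim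
  refine le_of_tendsto_of_tendsto hsum.hasSum hlim (Eventually.of_forall fun F => ?_)
  simp only [hfG, Finset.sum_add_distrib]
  rw [EReal.coe_add, ← ereal_coe_ennreal_sum, ← ereal_coe_real_sum,
    EReal.coe_ennreal_toReal htop]
  gcongr
  rw [← hGsum]
  exact_mod_cast ENNReal.sum_le_tsum F

/-! ### The Holevo quantity bounded by divergences -/

namespace Ensemble

variable {ι : Type v} (E : Ensemble H ι)

theorem average_ker_le {i : ι} (hi : 0 < E.prob i) {x : H} (hx : E.average.op x = 0) :
    (E.state i).op x = 0 := by
  refine apply_eq_zero_of_re_inner_eq_zero (E.state i).pos ?_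
  have h := E.hasSum_inner x
  have h0 : ∀ j, 0 ≤ E.prob j * (⟪x, (E.state j).op x⟫_ℂ).re := fun j =>
    mul_nonneg (E.prob_nonneg j) ((E.state j).pos.re_inner_nonneg_right x)
  change HasSum _ (⟪x, E.average.op x⟫_ℂ).re at h
  rw [hx, inner_zero_right, Complex.zero_re] at h
  have h1 := (hasSum_zero_iff_of_nonneg h0).1 h
  have h2 := congrFun h1 i
  exact (mul_eq_zero.1 h2).resolve_left hi.ne'

theorem holevo_le {B : ℝ≥0∞}
    (hB : ∑' i, ENNReal.ofReal (E.prob i) * spectralRelEntropy (E.state i) E.average ≤ B) :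
    E.holevo ≤ (B : EReal) := by
  unfold holevo
  by_cases hsum : Summable fun i => (E.prob i : EReal) * relEntropy (E.state i) E.average
  swap
  · rw [tsum_eq_zero_of_not_summable hsum]
    exact EReal.coe_ennreal_nonneg _
  refine le_of_tendsto hsum.hasSum (Eventually.of_forall fun F => ?_)
  refine le_trans (Finset.sum_le_sum fun i _ => ?_) ((ereal_coe_ennreal_sum F _).symm.trans_le
    (EReal.coe_ennreal_le_coe_ennreal_iff.2 ((ENNReal.sum_le_tsum F).trans hB)))
  rcases (E.prob_nonneg i).eq_or_lt with h0 | h0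
  -- A state of zero weight may have infinite relative entropy; the product is still 0 in `EReal`.
  · simp [← h0]
  · rw [EReal.coe_ennreal_mul, EReal.coe_ennreal_ofReal, max_eq_left h0.le]
    refine mul_le_mul_of_nonneg_left (relEntropy_le_spectralRelEntropy ?_)
      (by exact_mod_cast h0.le)
    exact Submodule.orthogonal_le fun x hx => E.average_ker_le h0 hx

theorem holevo_le_of_divergence [TopologicalSpace.SeparableSpace H] {B : ℝ≥0∞}
    (hB : ∑' i, ENNReal.ofReal (E.prob i) * divergence (E.state i).op E.average.op ≤ B) :
    E.holevo ≤ (B : EReal) := by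
  refine E.holevo_le (le_trans (ENNReal.tsum_le_tsum fun i => ?_) hB)
  rcases (E.prob_nonneg i).eq_or_lt with h0 | h0
  · simp [← h0]
  · gcongr
    exact spectralRelEntropy_le_divergence fun x hx => E.average_ker_le h0 hx

theorem hasSum_average : HasSum (fun i => (E.prob i : ℂ) • (E.state i).op) E.average.op :=
  E.summable_smul.hasSum

end Ensemble

end Entropy

/-! ### Upper bounds for the Holevo quantity -/

theorem g_zero : g 0 = 0 := by simp [g]

theorem g_nonneg {x : ℝ} (hx : 0 ≤ x) : 0 ≤ g x := by
  unfold g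
  have h1 : x / (1 + x) ≤ 1 := div_le_one_of_le₀ (by linarith) (by linarith)
  exact mul_nonneg (by linarith) (Real.binEntropy_nonneg (by positivity) h1)

theorem g_eq {x : ℝ} (hx : 0 < x) : g x = (1 + x) * Real.log (1 + x) - x * Real.log x := by
  have h1 : 1 - x / (1 + x) = (1 + x)⁻¹ := by field_simp; ring
  rw [g, Real.binEntropy, h1, inv_inv, inv_div, Real.log_div (by positivity) hx.ne']
  field_simp
  ring

theorem continuousAt_g {x : ℝ} (hx : 0 ≤ x) : ContinuousAt g x := by
  unfold g
  have h : 1 + x ≠ 0 := by positivity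
  have h1 : ContinuousAt (fun y : ℝ => 1 + y) x := by fun_prop
  exact h1.mul (Real.binEntropy_continuous.continuousAt.comp (continuousAt_id.div h1 h))

/-- Entropy is largest at the uniform weights: sum the scalar inequality `scalarRelEnt_nonneg`
against b = s/n. -/
theorem sum_neg_mul_log_le {ι : Type*} [Fintype ι] {a : ι → ℝ} (ha : ∀ i, 0 ≤ a i) {s : ℝ}
    (hs : ∑ i, a i = s) (hs0 : 0 < s) :
    ∑ i, -(a i * Real.log (a i)) ≤ s * Real.log (Fintype.card ι) - s * Real.log s := by
  have hne : Nonempty ι := by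
    by_contra h
    rw [not_nonempty_iff] at h
    simp at hs
    exact hs0.ne hs
  have hn : (0 : ℝ) < Fintype.card ι := by exact_mod_cast Fintype.card_pos
  have h1 : ∀ i, -(a i * Real.log (a i)) ≤
      a i * (Real.log (Fintype.card ι) - Real.log s) - a i + s / Fintype.card ι := by
    intro i
    have h := scalarRelEnt_nonneg (ha i) (div_pos hs0 hn).le fun h => absurd h (div_pos hs0 hn).ne'
    rw [scalarRelEnt, Real.log_div hs0.ne' hn.ne'] at h
    linarith
  refine (Finset.sum_le_sum fun i _ => h1 i).trans_eq ?_
  rw [Finset.sum_add_distrib, Finset.sum_sub_distrib, ← Finset.sum_mul, hs, Finset.sum_const,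
    Finset.card_univ, nsmul_eq_mul, mul_div_cancel₀ _ hn.ne']
  ring

/-! ### Bounds for a fixed reference state -/

namespace Ensemble

section Bounds

variable {H : Type u} [NormedAddCommGroup H] [InnerProductSpace ℂ H] [CompleteSpace H]
variable {ι : Type v} (E : Ensemble H ι)

theorem metricDivergence_ne_top (σ : State H) : E.metricDivergence σ ≠ ⊤ := by
  refine ENNReal.mul_ne_top (by simp) (ne_top_of_le_ne_top (b := 2) (by simp) ?_)
  calc ∑' i, ENNReal.ofReal (E.prob i) * traceNorm ((E.state i).op - σ.op)
      ≤ ∑' i, ENNReal.ofReal (E.prob i) * 2 := ENNReal.tsum_le_tsum fun i => by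
        gcongr
        exact traceNorm_sub_le_two _ _
    _ = 2 := by
        rw [ENNReal.tsum_mul_right, ← ENNReal.ofReal_tsum_of_nonneg E.prob_nonneg
          E.hasSum_prob.summable, E.hasSum_prob.tsum_eq, ENNReal.ofReal_one, one_mul]

theorem hasSum_metricDivergence (σ : State H) :
    HasSum (fun i => E.prob i * ((traceNorm ((E.state i).op - σ.op)).toReal / 2))
      (E.metricDivergence σ).toReal := by
  have h : E.metricDivergence σ =
      ∑' i, 2⁻¹ * (ENNReal.ofReal (E.prob i) * traceNorm ((E.state i).op - σ.op)) := by
    rw [metricDivergence, ENNReal.tsum_mul_left]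
  have hfin := E.metricDivergence_ne_top σ
  rw [h] at hfin ⊢
  have h1 := ENNReal.hasSum_toReal hfin
  rw [← ENNReal.tsum_toReal_eq (ENNReal.ne_top_of_tsum_ne_top hfin)] at h1
  refine h1.congr_fun fun i => ?_
  rw [ENNReal.toReal_mul, ENNReal.toReal_mul, ENNReal.toReal_ofReal (E.prob_nonneg i)]
  simp
  ring

/-- The estimate with Δ = (ε/d)·1. The terms e_i log e_i in the bound for D(P_i‖Δ) cancel those
coming from N_i, leaving −ε log(ε/d). -/
theorem holevo_le_finrank [FiniteDimensional ℂ H] (σ : State H)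
    (hσ : 0 < (E.metricDivergence σ).toReal) :
    E.holevo ≤ ((ENNReal.ofReal ((E.metricDivergence σ).toReal * Real.log (Module.finrank ℂ H) +
      g (E.metricDivergence σ).toReal) : ℝ≥0∞) : EReal) := by
  set ε := (E.metricDivergence σ).toReal with hε
  choose P N hP hN hPN htP htN using fun i => exists_add_eq_add_of_states (E.state i) σ
  have hsum := E.hasSum_metricDivergence σ
  rw [← hε] at hsum
  set e := fun i => (traceNorm ((E.state i).op - σ.op)).toReal / 2 with he
  have he0 : ∀ i, 0 ≤ e i := fun i => by positivity
  have htr : ∀ {A : H →L[ℂ] H} {a : ℝ}, A.IsPositive → 0 ≤ a → posTrace A = ENNReal.ofReal a →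
      reTrace A = a := fun hA ha h => by
    rw [posTrace_eq_ofReal_reTrace hA] at h
    exact (ENNReal.ofReal_eq_ofReal_iff (reTrace_nonneg hA) ha).1 h
  have htrP : ∀ i, reTrace (P i) = e i := fun i => htr (hP i) (he0 i) (htP i)
  have htrN : ∀ i, reTrace (N i) = e i := fun i => htr (hN i) (he0 i) (htN i)
  have htrs : ∀ ρ : State H, reTrace ρ.op = 1 := fun ρ =>
    htr ρ.pos zero_le_one (by rw [ρ.trace_eq_one, ENNReal.ofReal_one])
  have hd : (0 : ℝ) < Module.finrank ℂ H := by
    have : Nontrivial H := by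
      by_contra h
      rw [not_nontrivial_iff_subsingleton] at h
      have h1 : σ.op = 0 := Subsingleton.elim _ _
      have h2 := htrs σ
      rw [h1, reTrace_zero] at h2
      exact zero_ne_one h2
    exact_mod_cast Module.finrank_pos
  -- Normalized so that Δ = c·1 has trace ε.
  set c := ε / Module.finrank ℂ H with hc
  have hc0 : 0 < c := div_pos hσ hd
  have hone : (1 : H →L[ℂ] H).IsPositive := ContinuousLinearMap.isPositive_one
  have htr1 : reTrace ((c : ℂ) • (1 : H →L[ℂ] H)) = ε := by
    have : reTrace (1 : H →L[ℂ] H) = Module.finrank ℂ H := by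
      unfold reTrace
      have h1 : ((1 : H →L[ℂ] H) : H →ₗ[ℂ] H) = 1 := rfl
      rw [h1, LinearMap.trace_one]
      simp
    rw [reTrace_smul, this, hc, div_mul_cancel₀ _ hd.ne']
  have hmain := tsum_divergence_le E.prob_nonneg E.hasSum_prob (fun i => (E.state i).pos) hP hN
    σ.pos (isPositive_smul hone hc0.le) E.hasSum_average hPN
    (c := fun i => e i * -Real.log c) (fun i _ x hx => by
      have hx0 : x = 0 := by simpa [hc0.ne'] using hx
      rw [hx0, map_zero])
    (fun i _ => by
      have h1 := relEnt_smul_one_le (hP i) hc0.le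
      rw [htrP] at h1
      rw [htrN]
      linarith)
    (C := ε * -Real.log c) (by
      refine (hsum.mul_right (-Real.log c)).congr_fun fun i => ?_
      ring)
    (e := ε) (hsum.congr_fun fun i => by rw [htrN])
  have hsep : TopologicalSpace.SeparableSpace H := by
    have : SecondCountableTopology H :=
      (ContinuousLinearEquiv.ofFinrankEq (E := H)
        (F := EuclideanSpace ℂ (Fin (Module.finrank ℂ H))) (𝕜 := ℂ)
          (by simp)).toHomeomorph.secondCountableTopology
    infer_instance
  refine (E.holevo_le_of_divergence hmain).trans (EReal.coe_ennreal_le_coe_ennreal_iff.2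
    (ENNReal.ofReal_le_ofReal (le_of_eq ?_)))
  rw [htr1, htrs, htrs, hc, Real.log_div hσ.ne' hd.ne', g_eq hσ, Real.log_one]
  ring

/-- The estimate with Δ = ∑ p_i P_i, applied to compressions, where only the traces enter the
right-hand side. These converge, and lower semicontinuity carries the left-hand side to the limit.
-/
theorem holevo_le_card [TopologicalSpace.SeparableSpace H] [Fintype ι] (σ : State H)
    (hσ : 0 < (E.metricDivergence σ).toReal) :
    E.holevo ≤ ((ENNReal.ofReal ((E.metricDivergence σ).toReal * Real.log (Fintype.card ι) +
      g (E.metricDivergence σ).toReal) : ℝ≥0∞) : EReal) := by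
  set ε := (E.metricDivergence σ).toReal with hε
  choose P N hP hN hPN htP htN using fun i => exists_add_eq_add_of_states (E.state i) σ
  have hsum := E.hasSum_metricDivergence σ
  rw [← hε] at hsum
  set e := fun i => (traceNorm ((E.state i).op - σ.op)).toReal / 2 with he
  have he0 : ∀ i, 0 ≤ e i := fun i => by positivity
  have hsum' : ∑ i, E.prob i * e i = ε := (hasSum_fintype _).unique hsum
  have hcount : Countable (refIndex H) := countable_refIndex
  have lim : ∀ {A : H →L[ℂ] H} {a : ℝ}, A.IsPositive → 0 ≤ a → posTrace A = ENNReal.ofReal a →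
      Tendsto (fun F : Finset (refIndex H) => reTrace (compress F A)) atTop (𝓝 a) :=
    fun hA ha h => by
      have := tendsto_reTrace_compress hA (by rw [h]; simp)
      rwa [h, ENNReal.toReal_ofReal ha] at this
  have limP : ∀ i, Tendsto (fun F => reTrace (compress F (P i))) atTop (𝓝 (e i)) := fun i =>
    lim (hP i) (he0 i) (htP i)
  have limN : ∀ i, Tendsto (fun F => reTrace (compress F (N i))) atTop (𝓝 (e i)) := fun i =>
    lim (hN i) (he0 i) (htN i)
  have lims : ∀ ρ : State H, Tendsto (fun F => reTrace (compress F ρ.op)) atTop (𝓝 1) := fun ρ =>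
    lim ρ.pos zero_le_one (by rw [ρ.trace_eq_one, ENNReal.ofReal_one])
  let Δ := fun F : Finset (refIndex H) => ∑ i, (E.prob i : ℂ) • compress F (P i)
  have hΔs : ∀ F, HasSum (fun i => (E.prob i : ℂ) • compress F (P i)) (Δ F) := fun F =>
    hasSum_fintype _
  have hΔp : ∀ F, (Δ F).IsPositive := fun F =>
    isPositive_of_hasSum E.prob_nonneg (fun i => isPositive_compress (hP i) F) (hΔs F)
  have hk : ∀ F i, 0 < E.prob i → ∀ x, Δ F x = 0 → compress F (P i) x = 0 := fun F i hi x hx =>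
    apply_eq_zero_of_hasSum E.prob_nonneg (fun i => isPositive_compress (hP i) F) (hΔs F) hi hx
  have htrΔ : ∀ F, reTrace (Δ F) = ∑ i, E.prob i * reTrace (compress F (P i)) := fun F => by
    have h := hasSum_reTrace_comp (hΔs F) (ContinuousLinearMap.id ℂ _)
    simp only [ContinuousLinearMap.comp_id] at h
    exact h.unique (hasSum_fintype _)
  have limΔ : Tendsto (fun F => reTrace (Δ F)) atTop (𝓝 ε) := by
    simp_rw [htrΔ]
    rw [← hsum']
    exact tendsto_finsetSum _ fun i _ => (limP i).const_mul _
  have hrel : ∀ F i, 0 < E.prob i → relEnt (compress F (P i)) (Δ F) ≤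
      -(reTrace (compress F (P i)) * Real.log (E.prob i)) := fun F i hi => by
    have hPi := isPositive_compress (hP i) F
    -- Since Δ ≥ p_i P_i, monotonicity gives D(P_i‖Δ) ≤ D(P_i‖p_i P_i) = −Tr P_i · log p_i.
    have hle : (E.prob i : ℂ) • compress F (P i) ≤ Δ F := le_hasSum (hΔs F) i fun j _ => by
      rw [ContinuousLinearMap.nonneg_iff_isPositive]
      exact isPositive_smul (isPositive_compress (hP j) F) (E.prob_nonneg j)
    have hrest : (Δ F - (E.prob i : ℂ) • compress F (P i)).IsPositive := hle
    have h1 := relEnt_add_right_le hPi (isPositive_smul hPi hi.le) hrest fun x hx => by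
      rw [_root_.smul_apply, smul_eq_zero] at hx
      exact hx.resolve_left (by exact_mod_cast hi.ne')
    rwa [add_sub_cancel, relEnt_smul_self hPi hi] at h1
  let X := fun F : Finset (refIndex H) =>
    ∑ i, E.prob i * (-(reTrace (compress F (P i)) * Real.log (E.prob i)) -
        reTrace (compress F (N i)) * Real.log (reTrace (compress F (N i)))) +
      (∑ i, E.prob i * reTrace (compress F (N i))) *
        Real.log (reTrace (compress F σ.op) + reTrace (Δ F)) -
      reTrace (compress F E.average.op) * (Real.log (reTrace (compress F E.average.op)) -
        Real.log (reTrace (compress F σ.op) + reTrace (Δ F)))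
  have hX : ∀ F, ∑ i, ENNReal.ofReal (E.prob i) *
      divergence (compress F (E.state i).op) (compress F E.average.op) ≤ ENNReal.ofReal (X F) := by
    intro F
    rw [← tsum_fintype (L := SummationFilter.unconditional ι)]
    refine tsum_divergence_le E.prob_nonneg E.hasSum_prob
      (fun i => isPositive_compress (E.state i).pos F) (fun i => isPositive_compress (hP i) F)
      (fun i => isPositive_compress (hN i) F) (isPositive_compress σ.pos F) (hΔp F)
      (hasSum_compress E.hasSum_average F)
      (fun i => by rw [← compress_add, hPN, compress_add]) (hk F) (fun i hi => ?_)
      (hasSum_fintype _) (hasSum_fintype _)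
    exact sub_le_sub_right (hrel F i hi) _
  have hXlim : Tendsto X atTop (𝓝 (∑ i, E.prob i * (-(e i * Real.log (E.prob i)) -
      e i * Real.log (e i)) + (∑ i, E.prob i * e i) * Real.log (1 + ε) -
        1 * (Real.log 1 - Real.log (1 + ε)))) := by
    have hw : Tendsto (fun F => Real.log (reTrace (compress F σ.op) + reTrace (Δ F))) atTop
        (𝓝 (Real.log (1 + ε))) := ((lims σ).add limΔ).log (by positivity)
    refine ((tendsto_finsetSum _ fun i _ => Tendsto.const_mul _ ?_).add
      ((tendsto_finsetSum _ fun i _ => (limN i).const_mul _).mul hw)).sub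
        ((lims E.average).mul (((lims E.average).log one_ne_zero).sub hw))
    -- Continuity of x log x, also at 0, covers the indices with ρ_i = σ.
    exact ((limP i).mul_const _).neg.sub ((Real.continuous_mul_log.tendsto _).comp (limN i))
  have hdiv : ∑' i, ENNReal.ofReal (E.prob i) * divergence (E.state i).op E.average.op ≤
      ENNReal.ofReal (∑ i, E.prob i * (-(e i * Real.log (E.prob i)) -
      e i * Real.log (e i)) + (∑ i, E.prob i * e i) * Real.log (1 + ε) -
        1 * (Real.log 1 - Real.log (1 + ε))) := by
    rw [tsum_fintype]
    refine (sum_mul_divergence_le_liminf_compress E.prob (fun i => (E.state i).pos)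
      E.average.pos).trans ?_
    rw [← ((ENNReal.continuous_ofReal.tendsto _).comp hXlim).liminf_eq]
    exact liminf_le_liminf (Eventually.of_forall hX)
  refine (E.holevo_le_of_divergence hdiv).trans (EReal.coe_ennreal_le_coe_ennreal_iff.2
    (ENNReal.ofReal_le_ofReal ?_))
  have hent := sum_neg_mul_log_le (fun i => mul_nonneg (E.prob_nonneg i) (he0 i)) hsum' hσ
  -- The contributions of P_i and N_i combine into the entropy of the weights p_i e_i, whose total
  -- is ε.
  have heq : ∀ i, E.prob i * (-(e i * Real.log (E.prob i)) - e i * Real.log (e i)) =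
      -(E.prob i * e i * Real.log (E.prob i * e i)) := fun i => by
    rcases eq_or_ne (E.prob i) 0 with h0 | h0
    · simp [h0]
    rcases eq_or_ne (e i) 0 with h1 | h1
    · simp [h1]
    rw [Real.log_mul h0 h1]
    ring
  simp_rw [heq]
  rw [hsum', g_eq hσ, Real.log_one]
  linarith

/-! ### Passing to the infimum over reference states -/

theorem avgMetricDivergence_le (σ : State H) :
    E.avgMetricDivergence ≤ (E.metricDivergence σ).toReal :=
  ENNReal.toReal_mono (E.metricDivergence_ne_top σ) (iInf_le _ σ)

theorem nonempty_index (E : Ensemble H ι) : Nonempty ι := by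
  by_contra h
  rw [not_nonempty_iff] at h
  exact zero_ne_one (hasSum_empty.unique E.hasSum_prob)

theorem iInf_metricDivergence_ne_top : ⨅ σ : State H, E.metricDivergence σ ≠ ⊤ := by
  obtain ⟨i⟩ := E.nonempty_index
  exact ne_top_of_le_ne_top (E.metricDivergence_ne_top (E.state i)) (iInf_le _ _)

/-- The infimum need not be known to be attained: a minimizing sequence and continuity of Φ at its
limit suffice. -/
theorem holevo_le_of_forall {Φ : ℝ → ℝ} (hΦ : ContinuousAt Φ E.avgMetricDivergence)
    (h : ∀ σ : State H, E.holevo ≤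
      ((ENNReal.ofReal (Φ (E.metricDivergence σ).toReal) : ℝ≥0∞) : EReal)) :
    E.holevo ≤ ((ENNReal.ofReal (Φ E.avgMetricDivergence) : ℝ≥0∞) : EReal) := by
  obtain ⟨i⟩ := E.nonempty_index
  obtain ⟨s, -, hs, hmem⟩ := exists_seq_tendsto_sInf (S := Set.range E.metricDivergence)
    ⟨_, E.state i, rfl⟩ (OrderBot.bddBelow _)
  choose σ hσ using hmem
  have h1 : Tendsto (fun k => (s k).toReal) atTop (𝓝 E.avgMetricDivergence) :=
    (ENNReal.tendsto_toReal E.iInf_metricDivergence_ne_top).comp hs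
  have h2 := (continuous_coe_ennreal_ereal.tendsto _).comp
    ((ENNReal.continuous_ofReal.tendsto _).comp (hΦ.tendsto.comp h1))
  refine ge_of_tendsto h2 (Eventually.of_forall fun k => ?_)
  have := h (σ k)
  rwa [hσ k] at this

/-- Some σ of arbitrarily small metric divergence is close to both ρ_i and ρ_j, as their weights are
fixed and positive. Exchanging i and j then gives equality of the two operators. -/
theorem isPositive_sub_of_avgMetricDivergence_eq_zero (h : E.avgMetricDivergence = 0) {i j : ι}
    (hi : 0 < E.prob i) (hj : 0 < E.prob j) :
    ((E.state i).op - (E.state j).op).IsPositive := by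
  rw [ContinuousLinearMap.isPositive_def']
  refine ⟨(E.state i).isSelfAdjoint_sub _, fun x => ?_⟩
  have hinf : ⨅ σ : State H, E.metricDivergence σ = 0 :=
    ((ENNReal.toReal_eq_zero_iff _).1 h).resolve_right E.iInf_metricDivergence_ne_top
  have key : ∀ δ > 0, -δ ≤ (⟪x, ((E.state i).op - (E.state j).op) x⟫_ℂ).re := by
    intro δ hδ
    -- Chosen so that the two errors, at most 2(δ/K)/p each times ‖x‖², add up to at most δ; the
    -- extra 1 keeps K positive when x = 0.
    set K := 2 * ((E.prob i)⁻¹ + (E.prob j)⁻¹) * (‖x‖ ^ 2 + 1) with hK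
    have hK0 : 0 < K := by positivity
    obtain ⟨σ, hσ⟩ : ∃ σ : State H, E.metricDivergence σ < ENNReal.ofReal (δ / K) := by
      rw [← iInf_lt_iff, hinf, ENNReal.ofReal_pos]
      positivity
    have hσ' : (E.metricDivergence σ).toReal < δ / K :=
      (ENNReal.lt_ofReal_iff_toReal_lt (E.metricDivergence_ne_top σ)).1 hσ
    have ht : ∀ k, 0 < E.prob k →
        (traceNorm ((E.state k).op - σ.op)).toReal ≤ 2 * (δ / K) * (E.prob k)⁻¹ := by
      intro k hk
      have h1 := le_hasSum (E.hasSum_metricDivergence σ) k fun l _ =>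
        mul_nonneg (E.prob_nonneg l) (by positivity)
      rw [← div_eq_mul_inv, le_div_iff₀ hk]
      linarith
    have h1 := abs_le.1 (abs_re_inner_le_traceNorm (E.state i) σ x)
    have h2 := abs_le.1 (abs_re_inner_le_traceNorm (E.state j) σ x)
    have h3 : (⟪x, ((E.state i).op - (E.state j).op) x⟫_ℂ).re =
        (⟪x, ((E.state i).op - σ.op) x⟫_ℂ).re - (⟪x, ((E.state j).op - σ.op) x⟫_ℂ).re := by
      simp only [_root_.sub_apply, inner_sub_right, Complex.sub_re]
      ring
    have h4 : (traceNorm ((E.state i).op - σ.op)).toReal * ‖x‖ ^ 2 +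
        (traceNorm ((E.state j).op - σ.op)).toReal * ‖x‖ ^ 2 ≤ δ := by
      calc _ ≤ 2 * (δ / K) * (E.prob i)⁻¹ * (‖x‖ ^ 2 + 1) +
            2 * (δ / K) * (E.prob j)⁻¹ * (‖x‖ ^ 2 + 1) := by
            gcongr
            · exact ht i hi
            · linarith
            · exact ht j hj
            · linarith
        _ = δ / K * K := by rw [hK]; ring
        _ = δ := div_mul_cancel₀ _ hK0.ne'
    linarith [h1.1, h2.2]
  have h0 : 0 ≤ (⟪x, ((E.state i).op - (E.state j).op) x⟫_ℂ).re := by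
    by_contra! hneg
    have := key (-(⟪x, ((E.state i).op - (E.state j).op) x⟫_ℂ).re / 2) (by linarith)
    linarith
  rw [ContinuousLinearMap.reApplyInnerSelf_apply, inner_re_symm]
  exact h0

theorem holevo_le_zero (h : E.avgMetricDivergence = 0) : E.holevo ≤ 0 := by
  refine (E.holevo_le (B := 0) (le_of_eq ?_)).trans_eq EReal.coe_ennreal_zero
  rw [ENNReal.tsum_eq_zero]
  intro i
  rcases (E.prob_nonneg i).eq_or_lt with h0 | h0
  · simp [← h0]
  have heq : ∀ j, 0 < E.prob j → (E.state j).op = (E.state i).op := fun j hj =>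
    le_antisymm (E.isPositive_sub_of_avgMetricDivergence_eq_zero h h0 hj)
      (E.isPositive_sub_of_avgMetricDivergence_eq_zero h hj h0)
  have hav : E.average.op = (E.state i).op := by
    refine E.hasSum_average.unique ?_
    have h1 := (Complex.hasSum_ofReal.2 E.hasSum_prob).smul_const (E.state i).op
    rw [Complex.ofReal_one, one_smul] at h1
    refine h1.congr_fun fun j => ?_
    rcases (E.prob_nonneg j).eq_or_lt with hj | hj
    · simp [← hj]
    · rw [heq j hj]
  have hst : E.average = E.state i := by
    cases hA : E.average
    cases hB : E.state i
    simp only [hA, hB] at hav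
    simp only [hav]
  rw [hst, spectralRelEntropy_self, mul_zero]

theorem avgMetricDivergence_nonneg : 0 ≤ E.avgMetricDivergence := ENNReal.toReal_nonneg

/-- The bound with `m` states or `m` dimensions, from its version for every reference state. -/
theorem holevo_le_mul_log_add {m : ℝ≥0∞} (hm : 1 ≤ m)
    (h : 0 < E.avgMetricDivergence → m ≠ ⊤ → ∀ σ : State H,
      0 < (E.metricDivergence σ).toReal → E.holevo ≤ ((ENNReal.ofReal
        ((E.metricDivergence σ).toReal * Real.log m.toReal + g (E.metricDivergence σ).toReal) :
          ℝ≥0∞) : EReal)) :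
    E.holevo ≤ (E.avgMetricDivergence : EReal) * ENNReal.log m +
      (g E.avgMetricDivergence : EReal) := by
  rcases E.avgMetricDivergence_nonneg.eq_or_lt with h0 | h0
  -- The product 0 · log m is 0 in `EReal` even for m = ∞, so here χ ≤ 0 must be proved outright.
  · rw [← h0, g_zero, EReal.coe_zero, zero_mul, add_zero]
    exact E.holevo_le_zero h0.symm
  rcases eq_or_ne m ⊤ with rfl | hmt
  · rw [ENNReal.log_top, EReal.coe_mul_top_of_pos h0, EReal.top_add_coe]
    exact le_top
  have hm1 : 1 ≤ m.toReal := by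
    have := ENNReal.toReal_mono hmt hm
    rwa [ENNReal.toReal_one] at this
  have hcont : ContinuousAt (fun x => x * Real.log m.toReal + g x) E.avgMetricDivergence :=
    (continuousAt_id.mul continuousAt_const).add (continuousAt_g h0.le)
  refine (E.holevo_le_of_forall hcont fun σ =>
    h h0 hmt σ (h0.trans_le (E.avgMetricDivergence_le σ))).trans_eq ?_
  have hlog : ENNReal.log m = (Real.log m.toReal : EReal) := by
    conv_lhs => rw [← ENNReal.ofReal_toReal hmt]
    rw [ENNReal.log_ofReal, if_neg (by linarith)]
  rw [EReal.coe_ennreal_ofReal, max_eq_left, hlog, EReal.coe_add, EReal.coe_mul]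
  exact add_nonneg (mul_nonneg h0.le (Real.log_nonneg hm1)) (g_nonneg h0.le)

end Bounds

end Ensemble

end Quantum

end

/-- Upper bounds for the Holevo quantity of an ensemble of `n ≤ ∞` states in a separable Hilbert space
of dimension `d ≤ ∞` in terms of its average metric divergence (with `0 · ∞ = 0`). -/
theorem corollary4 {H : Type*} [NormedAddCommGroup H] [InnerProductSpace ℂ H] [CompleteSpace H]
    [TopologicalSpace.SeparableSpace H] {ι : Type*} [Countable ι] (E : Quantum.Ensemble H ι) :
    E.holevo ≤ (E.avgMetricDivergence : EReal) * ENNReal.log (ENat.card ι : ENNReal) +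
        (Quantum.g E.avgMetricDivergence : EReal) ∧
      E.holevo ≤ (E.avgMetricDivergence : EReal) *
          ENNReal.log (Cardinal.toENat (Module.rank ℂ H) : ENNReal) +
        (Quantum.g E.avgMetricDivergence : EReal) := by
  obtain ⟨i⟩ := E.nonempty_index
  constructor
  · refine E.holevo_le_mul_log_add ?_ fun _ hm σ hσ => ?_
    · have : (1 : ℕ∞) ≤ ENat.card ι := by
        rw [ENat.one_le_card_iff_nonempty]
        exact ⟨i⟩
      exact_mod_cast this
    · have hfin : Finite ι := by
        by_contra hinf
        rw [not_finite_iff_infinite] at hinf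
        exact hm (by simp)
      have := Fintype.ofFinite ι
      have h := E.holevo_le_card σ hσ
      simpa using h
  · refine E.holevo_le_mul_log_add ?_ fun _ hm σ hσ => ?_
    · have : (1 : ℕ∞) ≤ Cardinal.toENat (Module.rank ℂ H) := by
        have hn : Nontrivial H := by
          by_contra hn
          rw [not_nontrivial_iff_subsingleton] at hn
          have h1 : (E.state i).op = 0 := Subsingleton.elim _ _
          have h2 := (E.state i).trace_eq_one
          rw [h1] at h2
          simp [Quantum.posTrace] at h2
        rw [Cardinal.one_le_toENat, Cardinal.one_le_iff_pos]
        exact rank_pos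
      exact_mod_cast this
    -- `Module.rank` is the algebraic dimension, but `Cardinal.toENat` sends every infinite cardinal
    -- to ⊤, so only finite values matter, where it agrees with the Hilbert dimension.
    · have hfin : FiniteDimensional ℂ H := by
        rw [FiniteDimensional, ← Module.rank_lt_aleph0_iff]
        by_contra hinf
        refine hm ?_
        rw [Cardinal.toENat_eq_top.2 (not_lt.1 hinf)]
        simp
      have h := E.holevo_le_finrank σ hσ
      rwa [← Module.finrank_eq_rank, map_natCast, ENat.toENNReal_coe, ENNReal.toReal_natCast]
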